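/- Let $N\ge 1$ be an integer, $1<p<\infty$, $0<sp<N$ and $\chi>0$. Write $q'=q/(q-1)$ for $q>1$, and set $p_s^*=\frac{Np}{N-sp}$ and $m_c=p'-\frac{sp'}{N}$. Let $$K_{s/2}(x)=c\,|x|^{s-N},\qquad c=\pi^{-N/2}\,2^{-s}\,\frac{\Gamma((N-s)/2)}{\Gamma(s/2)},\qquad x\in\mathbb R^N .$$ For $m>1$ and $M>0$ let $$\mathcal Y_M=\Big\{\rho\in L^1(\mathbb R^N)\cap L^m(\mathbb R^N):\ \rho\ge 0 \text{ a.e.},\ |x|\rho\in L^1(\mathbb R^N),\ \int x\,\rho(x)\,dx=0,\ \int\rho\,dx=M\Big\},$$ and for $\rho\in\mathcal Y_M$ let $$\mathcal F_{s,p}(\rho)=\frac1{m-1}\int_{\mathbb R^N}\rho^m\,dx-\frac{\chi}{p'}\int_{\mathbb R^N}(K_{s/2}*\rho)^{p'}\,dx\ \in[-\infty,\infty).$$ Let $H^*$ be the best constant, for $m=m_c$, in the Hardy--Littlewood--Sobolev type inequality $$\|K_{s/2}*h\|_{p'}^{p'}\le H\,\|h\|_1^{p'\vartheta_0}\,\|h\|_m^{p'(1-\vartheta_0)}\quad\text{for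 all } 0\le h\in L^1(\mathbb R^N)\cap L^m(\mathbb R^N),\qquad \vartheta_0=1-\frac{m'}{p_s^*},$$ that is, the supremum over all such $h\neq0$ of the quotient of $\|K_{s/2}*h\|_{p'}^{p'}$ by $\|h\|_1^{p'\vartheta_0}\|h\|_m^{p'(1-\vartheta_0)}$. Then $0<H^*<\infty$; define the critical mass $$M_c=\Big(\frac{p_s^*}{\chi\,H^*}\Big)^{\frac{N}{sp'}} .$$ Then, for every $M>0$: 1. if $1<m<m_c$, then $\inf_{\mathcal Y_M}\mathcal F_{s,p}=-\infty$; 2. if $m>m_c$, then $\inf_{\mathcal Y_M}\mathcal F_{s,p}=\mu_s$ for some real number $\mu_s=\mu(N,p,s,\chi,m,M)<0$; 3. if $m=m_c$, then $\inf_{\mathcal Y_M}\mathcal F_{s,p}=0$ when $M\le M_c$, and $\inf_{\mathcal Y_M}\mathcal F_{s,p}=-\infty$ when $M>M_c$. -/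

import Mathlib

open MeasureTheory
open scoped ENNReal

noncomputable section

/-- Euclidean space `ℝ^N`. -/
abbrev RN (N : ℕ) : Type := EuclideanSpace ℝ (Fin N)

/-- The normalization `c_{N,s} = π^{-N/2} 2^{-2s} Γ(N/2 - s) / Γ(s)` of the Riesz kernel. -/
def rieszConst (N : ℕ) (s : ℝ) : ℝ :=
  Real.pi ^ (-((N : ℝ) / 2)) * (2 : ℝ) ^ (-(2 * s)) *
    (Real.Gamma ((N : ℝ) / 2 - s) / Real.Gamma s)

/-- The Riesz kernel `K_s(x) = c_{N,s} |x|^{2s - N}` (its value at the origin is irrelevant). -/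
def rieszKernel (N : ℕ) (s : ℝ) (x : RN N) : ℝ :=
  rieszConst N s * ‖x‖ ^ (2 * s - (N : ℝ))

/-- The Riesz potential `K_s * ρ` of an (almost everywhere) nonnegative function, with values in
`[0, ∞]`. -/
def rieszPotential (N : ℕ) (s : ℝ) (ρ : RN N → ℝ) (x : RN N) : ℝ≥0∞ :=
  ∫⁻ y, ENNReal.ofReal (rieszKernel N s (x - y)) * ENNReal.ofReal (ρ y)

/-- The conjugate exponent `q' = q / (q - 1)`. -/
def conjExp (q : ℝ) : ℝ := q / (q - 1)

/-- The exponent `p_s^* = N p / (N - s p)`. -/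
def sobolevExp (N : ℕ) (s p : ℝ) : ℝ := (N : ℝ) * p / ((N : ℝ) - s * p)

/-- The critical exponent `m_c = p' - s p' / N`. -/
def critExp (N : ℕ) (s p : ℝ) : ℝ := conjExp p - s * conjExp p / (N : ℝ)

/-- `‖K_{s/2} * ρ‖_{p'}^{p'}`, with values in `[0, ∞]`. -/
def potentialPower (N : ℕ) (s p : ℝ) (ρ : RN N → ℝ) : ℝ≥0∞ :=
  ∫⁻ x, rieszPotential N (s / 2) ρ x ^ conjExp p

/-- The `(s,p)` energy `I_{s,p}(ρ) = (1 / p') ∫ (K_{s/2} * ρ)^{p'}`, with values in `[0, ∞]`. -/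
def spEnergy (N : ℕ) (s p : ℝ) (ρ : RN N → ℝ) : ℝ≥0∞ :=
  ENNReal.ofReal (1 / conjExp p) * potentialPower N s p ρ

/-- `L^1_+(ℝ^N) ∩ L^m(ℝ^N)`. -/
def nonnegL1Lm (N : ℕ) (m : ℝ) : Set (RN N → ℝ) :=
  {ρ | 0 ≤ᵐ[volume] ρ ∧ Integrable ρ volume ∧ MemLp ρ (ENNReal.ofReal m) volume}

/-- The class `Y_M = Y_{M,m}`: nonnegative functions in `L^1 ∩ L^m` of mass `M` whose center of
mass is (well defined and) the origin. -/
def massClass (N : ℕ) (m M : ℝ) : Set (RN N → ℝ) :=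
  {ρ | ρ ∈ nonnegL1Lm N m ∧
    Integrable (fun x => ρ x • x) volume ∧ ∫ x, ρ x • x = 0 ∧ ∫ x, ρ x = M}

/-- The free energy
`F_{s,p}(ρ) = (1 / (m - 1)) ∫ ρ^m - (χ / p') ∫ (K_{s/2} * ρ)^{p'}`. On `L^1_+ ∩ L^m` the first
term is finite, so the difference is a well defined element of `[-∞, ∞)`. -/
def freeEnergy (N : ℕ) (s p χ m : ℝ) (ρ : RN N → ℝ) : EReal :=
  ((ENNReal.ofReal (1 / (m - 1)) * ∫⁻ x, ENNReal.ofReal (ρ x) ^ m : ℝ≥0∞) : EReal) -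
    ((ENNReal.ofReal χ * spEnergy N s p ρ : ℝ≥0∞) : EReal)

/-- The infimum of `F_{s,p}` over `Y_M`, in `[-∞, ∞]`. -/
def infEnergy (N : ℕ) (s p χ m M : ℝ) : EReal :=
  ⨅ ρ ∈ massClass N m M, freeEnergy N s p χ m ρ

/-- The interpolation exponent `ϑ₀ = 1 - m' / p_s^*`. -/
def interpExp (N : ℕ) (s p m : ℝ) : ℝ := 1 - conjExp m / sobolevExp N s p

/-- The best constant `H^*_{m,s,p}` in
`‖K_{s/2} * h‖_{p'}^{p'} ≤ H ‖h‖_1^{p' ϑ₀} ‖h‖_m^{p' (1 - ϑ₀)}`, `h ∈ L^1_+ ∩ L^m`, as the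
supremum in `[0, ∞]` of the quotients over `h ≠ 0`. -/
def hlsBestConst (N : ℕ) (s p m : ℝ) : ℝ≥0∞ :=
  ⨆ h ∈ {h : RN N → ℝ | h ∈ nonnegL1Lm N m ∧ ¬ h =ᵐ[volume] 0},
    potentialPower N s p h /
      (eLpNorm h 1 volume ^ (conjExp p * interpExp N s p m) *
        eLpNorm h (ENNReal.ofReal m) volume ^ (conjExp p * (1 - interpExp N s p m)))

/-- The critical mass `M_c = (p_s^* / (χ H^*_{m_c,s,p}))^{N / (s p')}`. -/
def critMass (N : ℕ) (s p χ : ℝ) : ℝ :=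
  (sobolevExp N s p / (χ * (hlsBestConst N s p (critExp N s p)).toReal)) ^
    ((N : ℝ) / (s * conjExp p))

end

/-!
Write `q = p'`, `m_c = q (1 - s / N)` and, for a density `ρ` of mass `M`, let `A = ∫ ρ ^ m` and
`B = ∫ (K_{s/2} * ρ) ^ q`. The dilation `ρ_t(x) = t ^ N ρ(t x)` preserves mass and centre of mass,
multiplies `A` by `t ^ (N (m - 1))` and `B` by `t ^ (N (m_c - 1))` (`infEnergy_le_dilate`). Hence
for `m < m_c` concentration (`t → ∞`) drives the free energy of any density to `-∞`, and for
`m > m_c` spreading (`t → 0`) makes it negative.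

The lower bounds come from the inequality `B ≤ H* M ^ (q - m_c) ∫ ρ ^ m_c` with `H* < ∞`
(`hlsBestConst_lt_top`, `potentialPower_le_hlsBestConst`). The endpoint inequality for `L^r`
functions is not needed: only the `L^1` and `L^{m_c}` norms enter, so one cuts the kernel at radius
one and applies Young's convolution inequality, with the singular part in `L^a` for some
`a < N / (N - s)` acting on `L^{m_c}` and the tail in `L^q` acting on `L^1`
(`exists_lintegral_rieszKernel_rpow_le`). This bounds `B` for densities with unit norms; dilation
turns the bound into the scale invariant one (`exists_potentialPower_le`). For `m > m_c` the
pointwise bound `x ^ m_c ≤ ε x ^ m + C x` then gives a finite lower bound.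

At `m = m_c` both parts of the energy scale alike. If `M ≤ M_c` the inequality gives a nonnegative
energy, and spreading sends it to zero. If `M > M_c`, a near-optimal function for `H*` has negative
energy once it has been truncated to a ball, centred and rescaled to mass `M`
(`exists_mem_massClass_lt_potentialPower`), and concentration sends its energy to `-∞`.
-/

/-! ### Young's convolution inequality for nonnegative functions -/

theorem ENNReal.rpow_mul_rpow_le_add (a b : ℝ≥0∞) {u v : ℝ} (hu : 0 ≤ u) (hv : 0 ≤ v)
    (huv : u + v = 1) : a ^ u * b ^ v ≤ a + b := by
  calc a ^ u * b ^ v ≤ (a + b) ^ u * (a + b) ^ v := by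
        gcongr
        · exact le_self_add
        · exact le_add_self
    _ = a + b := by rw [← ENNReal.rpow_add_of_nonneg _ _ hu hv, huv, ENNReal.rpow_one]

/-- Young's convolution inequality without the sharp constant: the right-hand side depends only on
the two integrals, which suffices for finiteness. -/
theorem lintegral_convolution_rpow_le {N : ℕ} {g f : RN N → ℝ≥0∞} (hg : Measurable g)
    (hf : Measurable f) {a m q : ℝ} (hq : 1 < q) (ha : 1 ≤ a) (hm : 1 ≤ m)
    (h : 1 / a + 1 / m = 1 + 1 / q) :
    ∫⁻ x, (∫⁻ y, g (x - y) * f y) ^ q ≤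
      (∫⁻ x, g x ^ a) * (∫⁻ x, f x ^ m) * ((∫⁻ x, g x ^ a) + ∫⁻ x, f x ^ m) ^ (q - 1) := by
  set A := ∫⁻ x, g x ^ a
  set B := ∫⁻ x, f x ^ m
  have hq0 : 0 < q := by linarith
  have ha0 : 0 < a := by linarith
  have hm0 : 0 < m := by linarith
  set p := q / (q - 1) with hp
  have hq1 : 0 < q - 1 := by linarith
  have hp0 : 0 < p := div_pos hq0 hq1
  have hpq : q.HolderConjugate p := Real.HolderConjugate.conjExponent hq
  have hm1 : 0 ≤ 1 - 1 / m := by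
    have : 1 / m ≤ 1 := by rw [div_le_one hm0]; exact hm
    linarith
  have hmq : 0 ≤ 1 / m - 1 / q := by
    have : 1 / a ≤ 1 := by rw [div_le_one ha0]; exact ha
    linarith
  have hA : ∀ x, ∫⁻ y, g (x - y) ^ a = A := fun x =>
    lintegral_sub_left_eq_self (fun y => g y ^ a) x
  have hgx : ∀ x, Measurable fun y => g (x - y) := fun x =>
    hg.comp (measurable_const.sub measurable_id)
  -- the integrand is split as `(g ^ a f ^ m) ^ (1 / q)` times a factor whose `p`-th power is a
  -- weighted geometric mean of `g ^ a` and `f ^ m`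
  have key : ∀ x, (∫⁻ y, g (x - y) * f y) ^ q ≤
      (∫⁻ y, g (x - y) ^ a * f y ^ m) * (A + B) ^ (q - 1) := by
    intro x
    have e1 : ∫⁻ y, g (x - y) * f y =
        ∫⁻ y, ((fun y => (g (x - y) ^ a * f y ^ m) ^ (1 / q)) *
          (fun y => g (x - y) ^ (a * (1 - 1 / m)) * f y ^ (m * (1 / m - 1 / q)))) y := by
      refine lintegral_congr fun y => ?_
      simp only [Pi.mul_apply]
      rw [ENNReal.mul_rpow_of_nonneg _ _ (by positivity), ← ENNReal.rpow_mul, ← ENNReal.rpow_mul,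
        mul_mul_mul_comm, ← ENNReal.rpow_add_of_nonneg _ _ (by positivity) (by positivity),
        ← ENNReal.rpow_add_of_nonneg _ _ (by positivity) (by positivity)]
      have t1 : a * (1 / q) + a * (1 - 1 / m) = 1 := by
        have : a * (1 / q) + a * (1 - 1 / m) = a * (1 / a) := by
          rw [← mul_add]; congr 1; linarith
        rw [this]; field_simp
      have t2 : m * (1 / q) + m * (1 / m - 1 / q) = 1 := by field_simp; ring
      rw [t1, t2, ENNReal.rpow_one, ENNReal.rpow_one]
    have e2 := ENNReal.lintegral_mul_le_Lp_mul_Lq volume hpq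
      (f := fun y => (g (x - y) ^ a * f y ^ m) ^ (1 / q))
      (g := fun y => g (x - y) ^ (a * (1 - 1 / m)) * f y ^ (m * (1 / m - 1 / q)))
      ((((hgx x).pow_const _).mul (hf.pow_const _)).pow_const _).aemeasurable
      (((hgx x).pow_const _).mul (hf.pow_const _)).aemeasurable
    rw [← e1] at e2
    have e3 : ∫⁻ y, (g (x - y) ^ (a * (1 - 1 / m)) * f y ^ (m * (1 / m - 1 / q))) ^ p ≤ A + B := by
      rw [← hA x, ← lintegral_add_left ((hgx x).pow_const _)]
      refine lintegral_mono fun y => ?_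
      rw [ENNReal.mul_rpow_of_nonneg _ _ hp0.le, ← ENNReal.rpow_mul, ← ENNReal.rpow_mul,
        mul_assoc, mul_assoc, ENNReal.rpow_mul, ENNReal.rpow_mul (f y)]
      refine ENNReal.rpow_mul_rpow_le_add _ _ (by positivity) (by positivity) ?_
      rw [← add_mul, hp]; field_simp; ring
    have e4 : ∀ y, ((g (x - y) ^ a * f y ^ m) ^ (1 / q)) ^ q = g (x - y) ^ a * f y ^ m := by
      intro y
      rw [← ENNReal.rpow_mul, one_div_mul_cancel hq0.ne', ENNReal.rpow_one]
    simp only [e4] at e2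
    calc (∫⁻ y, g (x - y) * f y) ^ q
        ≤ ((∫⁻ y, g (x - y) ^ a * f y ^ m) ^ (1 / q) * (A + B) ^ (1 / p)) ^ q := by
          gcongr
          exact e2.trans (by gcongr)
      _ = _ := by
          rw [ENNReal.mul_rpow_of_nonneg _ _ hq0.le, ← ENNReal.rpow_mul, ← ENNReal.rpow_mul,
            one_div_mul_cancel hq0.ne', ENNReal.rpow_one]
          congr 2
          rw [hp]; field_simp
  have hmeas : Measurable (Function.uncurry fun x y => g (x - y) ^ a * f y ^ m) :=
    ((hg.comp (measurable_fst.sub measurable_snd)).pow_const a).mul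
      ((hf.comp measurable_snd).pow_const m)
  calc ∫⁻ x, (∫⁻ y, g (x - y) * f y) ^ q
      ≤ ∫⁻ x, (∫⁻ y, g (x - y) ^ a * f y ^ m) * (A + B) ^ (q - 1) := lintegral_mono key
    _ = (∫⁻ x, ∫⁻ y, g (x - y) ^ a * f y ^ m) * (A + B) ^ (q - 1) :=
        lintegral_mul_const _ hmeas.lintegral_prod_right'
    _ = A * B * (A + B) ^ (q - 1) := by
        rw [lintegral_lintegral_swap hmeas.aemeasurable]
        congr 1
        rw [← lintegral_const_mul _ (hf.pow_const m)]
        refine lintegral_congr fun y => ?_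
        have hgy : Measurable fun x => g (x - y) ^ a :=
          (hg.comp (measurable_id.sub_const y)).pow_const a
        rw [lintegral_mul_const _ hgy]
        congr 1
        exact lintegral_sub_right_eq_self (fun x => g x ^ a) y

/-! ### The Riesz kernel near the origin and at infinity -/

theorem rieszConst_pos {N : ℕ} {s : ℝ} (hs : 0 < s) (hsN : s < N) : 0 < rieszConst N (s / 2) := by
  have h1 := Real.Gamma_pos_of_pos (show 0 < (N : ℝ) / 2 - s / 2 by linarith)
  have h2 := Real.Gamma_pos_of_pos (show 0 < s / 2 by linarith)
  unfold rieszConst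
  positivity

theorem measurable_rieszKernel (N : ℕ) (s : ℝ) :
    Measurable fun x : RN N => ENNReal.ofReal (rieszKernel N s x) := by
  unfold rieszKernel
  fun_prop

theorem lintegral_ball_norm_rpow_lt_top {N : ℕ} (hN : 0 < N) {b : ℝ} (hb : -(N : ℝ) < b) :
    ∫⁻ x in Metric.ball (0 : RN N) 1, ENNReal.ofReal (‖x‖ ^ b) < ⊤ := by
  have : Nonempty (Fin N) := ⟨⟨0, hN⟩⟩
  have h : IntegrableOn (fun x : RN N => ‖x‖ ^ b) (Metric.ball 0 1) := by
    refine (integrableOn_fun_norm_addHaar volume (f := fun y : ℝ => y ^ b)).2 ?_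
    have h' : IntegrableOn (fun y : ℝ => y ^ ((N : ℝ) - 1 + b)) (Set.Ioo 0 1) :=
      (intervalIntegral.integrableOn_Ioo_rpow_iff one_pos).2 (by linarith)
    refine h'.congr_fun (fun y hy => ?_) measurableSet_Ioo
    simp only [finrank_euclideanSpace, Fintype.card_fin, smul_eq_mul]
    rw [Real.rpow_add hy.1, ← Real.rpow_natCast, Nat.cast_sub hN, Nat.cast_one]
  exact h.lintegral_lt_top

theorem lintegral_compl_ball_norm_rpow_lt_top {N : ℕ} (hN : 0 < N) {b : ℝ} (hb : b < -(N : ℝ)) :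
    ∫⁻ x in (Metric.ball (0 : RN N) 1)ᶜ, ENNReal.ofReal (‖x‖ ^ b) < ⊤ := by
  have : Nonempty (Fin N) := ⟨⟨0, hN⟩⟩
  have h : Integrable (fun x : RN N => (Set.Ici (1 : ℝ)).indicator (fun y => y ^ b) ‖x‖) := by
    refine (integrable_fun_norm_addHaar volume
      (f := (Set.Ici (1 : ℝ)).indicator (fun y => y ^ b))).2 ?_
    have h' : IntegrableOn (fun y : ℝ => y ^ ((N : ℝ) - 1 + b)) (Set.Ici 1) :=
      (integrableOn_Ici_iff_integrableOn_Ioi (by finiteness)).2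
        (integrableOn_Ioi_rpow_of_lt (by linarith) one_pos)
    refine ((integrable_indicator_iff measurableSet_Ici).2 h').integrableOn.congr_fun
      (fun y hy => ?_) measurableSet_Ioi
    simp only [finrank_euclideanSpace, Fintype.card_fin, smul_eq_mul]
    by_cases h1 : y ∈ Set.Ici (1 : ℝ)
    · rw [Set.indicator_of_mem h1, Set.indicator_of_mem h1, Real.rpow_add hy,
        ← Real.rpow_natCast, Nat.cast_sub hN, Nat.cast_one]
    · simp [Set.indicator_of_notMem h1]
  have h2 : IntegrableOn (fun x : RN N => ‖x‖ ^ b) (Metric.ball (0 : RN N) 1)ᶜ := by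
    refine h.integrableOn.congr_fun (fun x hx => ?_) measurableSet_ball.compl
    have : ‖x‖ ∈ Set.Ici (1 : ℝ) := by simpa using hx
    simp only [Set.indicator_of_mem this]
  exact h2.lintegral_lt_top

theorem ofReal_rieszKernel_rpow {N : ℕ} {s : ℝ} (hs : 0 < s) (hsN : s < N) {a : ℝ} (ha : 0 ≤ a)
    (x : RN N) : ENNReal.ofReal (rieszKernel N (s / 2) x) ^ a =
      ENNReal.ofReal (rieszConst N (s / 2) ^ a) * ENNReal.ofReal (‖x‖ ^ ((s - N) * a)) := by
  have hc := rieszConst_pos hs hsN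
  unfold rieszKernel
  rw [ENNReal.ofReal_rpow_of_nonneg (by positivity) ha, Real.mul_rpow hc.le (by positivity),
    ← Real.rpow_mul (norm_nonneg x), ENNReal.ofReal_mul (by positivity)]
  congr 4
  ring

/-! ### The Hardy–Littlewood–Sobolev type inequality for normalized functions -/

/-- At the critical exponent `m = q (1 - s / N)`, the kernel near the origin is controlled in
`L^q` by the `L^m` norm, and the tail of the kernel, which is in `L^q`, by the `L^1` norm. -/
theorem exists_lintegral_rieszKernel_rpow_le {N : ℕ} {s q m : ℝ} (hs : 0 < s) (hsN : s < N)
    (hm : 1 < m) (hmq : m = q * (1 - s / N)) :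
    ∃ C : ℝ≥0∞, C < ⊤ ∧ ∀ f : RN N → ℝ≥0∞, Measurable f → ∫⁻ x, f x = 1 → ∫⁻ x, f x ^ m = 1 →
      ∫⁻ x, (∫⁻ y, ENNReal.ofReal (rieszKernel N (s / 2) (x - y)) * f y) ^ q ≤ C := by
  have hN0 : (0 : ℝ) < N := hs.trans hsN
  have hN : 0 < N := by exact_mod_cast hN0
  have hsN1 : 0 < 1 - s / N := by rw [sub_pos, div_lt_one hN0]; exact hsN
  have hsN2 : 0 < s / N := by positivity
  have hqm : m < q := by
    have : 0 < q := by
      by_contra hq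
      push Not at hq
      nlinarith
    nlinarith
  have hq1 : 1 < q := hm.trans hqm
  have hq0 : 0 < q := by linarith
  have hm0 : 0 < m := by linarith
  -- Young's inequality takes `L^(1/d) * L^m` to `L^q`; as `1 / d < N / (N - s)`, the kernel is in
  -- `L^(1/d)` near the origin
  set d := 1 + 1 / q - 1 / m with hd
  have hdm : 1 / q < 1 / m := one_div_lt_one_div_of_lt hm0 hqm
  have hm1 : 1 / m < 1 := by rw [div_lt_one hm0]; exact hm
  have hq' : 0 < 1 / q := by positivity
  have hd0 : 0 < d := by linarith
  have hd1 : d < 1 := by linarith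
  have hds : 1 - s / N < d := by
    have e1 : 1 - s / N = m / q := by rw [hmq]; field_simp
    have e2 : d - m / q = (q - m) * (m - 1) / (q * m) := by rw [hd]; field_simp; ring
    have : 0 < (q - m) * (m - 1) / (q * m) :=
      div_pos (mul_pos (by linarith) (by linarith)) (by positivity)
    linarith
  have ha1 : 1 ≤ 1 / d := by rw [le_div_iff₀ hd0]; linarith
  set K : RN N → ℝ≥0∞ := fun x => ENNReal.ofReal (rieszKernel N (s / 2) x) with hK
  have hKm : Measurable K := measurable_rieszKernel N (s / 2)
  set U := Metric.ball (0 : RN N) 1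
  have hU : MeasurableSet U := measurableSet_ball
  set K₁ := U.indicator K with hK₁
  set K₂ := Uᶜ.indicator K with hK₂
  have hK₁m : Measurable K₁ := hKm.indicator hU
  have hK₂m : Measurable K₂ := hKm.indicator hU.compl
  have hind : ∀ (V : Set (RN N)), MeasurableSet V → ∀ a : ℝ, 0 < a →
      ∫⁻ x, V.indicator K x ^ a =
        ENNReal.ofReal (rieszConst N (s / 2) ^ a) *
          ∫⁻ x in V, ENNReal.ofReal (‖x‖ ^ ((s - N) * a)) := by
    intro V hV a ha
    rw [← lintegral_const_mul _ (by fun_prop), ← lintegral_indicator hV]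
    refine lintegral_congr fun x => ?_
    by_cases hx : x ∈ V
    · rw [Set.indicator_of_mem hx, Set.indicator_of_mem hx,
        ofReal_rieszKernel_rpow hs hsN ha.le]
    · rw [Set.indicator_of_notMem hx, Set.indicator_of_notMem hx, ENNReal.zero_rpow_of_pos ha]
  have hA₁ : ∫⁻ x, K₁ x ^ (1 / d) < ⊤ := by
    rw [hind U hU _ (by positivity)]
    refine ENNReal.mul_lt_top ENNReal.ofReal_lt_top (lintegral_ball_norm_rpow_lt_top hN ?_)
    have : (s - N) * (1 / d) = -((1 - s / N) / d * N) := by field_simp; ring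
    rw [this]
    have h1 : (1 - s / N) / d < 1 := by rw [div_lt_one hd0]; exact hds
    nlinarith
  have hA₂ : ∫⁻ x, K₂ x ^ q < ⊤ := by
    rw [hind Uᶜ hU.compl _ hq0]
    refine ENNReal.mul_lt_top ENNReal.ofReal_lt_top (lintegral_compl_ball_norm_rpow_lt_top hN ?_)
    have : (s - N) * q = -(m * N) := by rw [hmq]; field_simp; ring
    rw [this]
    nlinarith
  set A₁ := ∫⁻ x, K₁ x ^ (1 / d)
  set A₂ := ∫⁻ x, K₂ x ^ q
  refine ⟨2 ^ (q - 1) * (A₁ * (A₁ + 1) ^ (q - 1) + A₂ * (A₂ + 1) ^ (q - 1)), ?_, ?_⟩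
  · have h1 : (A₁ + 1) ^ (q - 1) < ⊤ :=
      ENNReal.rpow_lt_top_of_nonneg (by linarith) (by simp [hA₁.ne])
    have h2 : (A₂ + 1) ^ (q - 1) < ⊤ :=
      ENNReal.rpow_lt_top_of_nonneg (by linarith) (by simp [hA₂.ne])
    have h3 : (2 : ℝ≥0∞) ^ (q - 1) < ⊤ := ENNReal.rpow_lt_top_of_nonneg (by linarith) (by simp)
    exact ENNReal.mul_lt_top h3
      (ENNReal.add_lt_top.2 ⟨ENNReal.mul_lt_top hA₁ h1, ENNReal.mul_lt_top hA₂ h2⟩)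
  · intro f hf hf1 hfm
    have hsplit : ∀ x, ∫⁻ y, K (x - y) * f y =
        (∫⁻ y, K₁ (x - y) * f y) + ∫⁻ y, K₂ (x - y) * f y := by
      intro x
      have hm₁ : Measurable fun y => K₁ (x - y) * f y :=
        (hK₁m.comp (measurable_const.sub measurable_id)).mul hf
      rw [← lintegral_add_left hm₁]
      refine lintegral_congr fun y => ?_
      rw [← add_mul, hK₁, hK₂, Set.indicator_self_add_compl_apply]
    have hY1 := lintegral_convolution_rpow_le hK₁m hf hq1 ha1 hm.le
      (by rw [one_div_one_div, hd]; ring)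
    have hY2 := lintegral_convolution_rpow_le hK₂m hf hq1 hq1.le le_rfl (by ring)
    simp only [ENNReal.rpow_one, hf1, hfm, mul_one] at hY1 hY2
    have hmeas : Measurable fun x => (∫⁻ y, K₁ (x - y) * f y) ^ q := by
      have : Measurable (Function.uncurry fun x y => K₁ (x - y) * f y) :=
        (hK₁m.comp (measurable_fst.sub measurable_snd)).mul (hf.comp measurable_snd)
      exact (this.lintegral_prod_right').pow_const q
    calc ∫⁻ x, (∫⁻ y, K (x - y) * f y) ^ q
        ≤ ∫⁻ x, 2 ^ (q - 1) * ((∫⁻ y, K₁ (x - y) * f y) ^ q +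
            (∫⁻ y, K₂ (x - y) * f y) ^ q) := by
          refine lintegral_mono fun x => ?_
          rw [hsplit]
          exact ENNReal.rpow_add_le_mul_rpow_add_rpow _ _ hq1.le
      _ = 2 ^ (q - 1) * ((∫⁻ x, (∫⁻ y, K₁ (x - y) * f y) ^ q) +
            ∫⁻ x, (∫⁻ y, K₂ (x - y) * f y) ^ q) := by
          rw [lintegral_const_mul' _ _ (ENNReal.rpow_ne_top_of_nonneg (by linarith) (by simp)),
            lintegral_add_left hmeas]
      _ ≤ _ := by gcongr

/-! ### Exponents -/

section Exponents

variable {N : ℕ} {s p : ℝ}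

theorem one_lt_conjExp (hp : 1 < p) : 1 < conjExp p := by
  unfold conjExp
  rw [lt_div_iff₀ (by linarith)]
  linarith

theorem critExp_eq (N : ℕ) (s p : ℝ) : critExp N s p = conjExp p * (1 - s / N) := by
  unfold critExp
  ring

theorem critExp_sub_one (hp : 1 < p) (hsp : 0 < s * p) (hspN : s * p < N) :
    critExp N s p - 1 = (N - s * p) / (N * (p - 1)) := by
  have hN : (0 : ℝ) < N := hsp.trans hspN
  have hp1 : 0 < p - 1 := by linarith
  unfold critExp conjExp
  field_simp
  ring

theorem one_lt_critExp (hp : 1 < p) (hsp : 0 < s * p) (hspN : s * p < N) :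
    1 < critExp N s p := by
  have hN : (0 : ℝ) < N := hsp.trans hspN
  have hp1 : 0 < p - 1 := by linarith
  have h1 := critExp_sub_one hp hsp hspN
  have h2 : 0 < (N - s * p) / (N * (p - 1)) := div_pos (by linarith) (by positivity)
  linarith

theorem critExp_sub_one_mul_sobolevExp (hp : 1 < p) (hsp : 0 < s * p) (hspN : s * p < N) :
    (critExp N s p - 1) * sobolevExp N s p = conjExp p := by
  have hN : (N : ℝ) ≠ 0 := (hsp.trans hspN).ne'
  have hNs : (N : ℝ) - s * p ≠ 0 := by linarith
  rw [critExp_sub_one hp hsp hspN, sobolevExp, conjExp, div_mul_div_comm, mul_comm ((N : ℝ) - s * p),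
    mul_div_mul_right _ _ hNs, mul_div_mul_left _ _ hN]

theorem sobolevExp_pos (hp : 1 < p) (hsp : 0 < s * p) (hspN : s * p < N) :
    0 < sobolevExp N s p := by
  have hN : (0 : ℝ) < N := hsp.trans hspN
  exact div_pos (by positivity) (by linarith)

/-- The exponent of the `L^m` norm in the interpolation inequality is `m` itself: this is what
makes `m = m_c` the fair competition exponent. -/
theorem conjExp_mul_one_sub_interpExp (hp : 1 < p) (hsp : 0 < s * p) (hspN : s * p < N) :
    conjExp p * (1 - interpExp N s p (critExp N s p)) = critExp N s p := by
  have h1 := one_lt_critExp hp hsp hspN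
  have h2 := critExp_sub_one_mul_sobolevExp hp hsp hspN
  have h3 := sobolevExp_pos hp hsp hspN
  have h4 : critExp N s p - 1 ≠ 0 := by linarith
  have h5 : conjExp (critExp N s p) = critExp N s p / (critExp N s p - 1) := rfl
  unfold interpExp
  rw [h5, ← h2]
  field_simp
  ring

theorem conjExp_mul_interpExp (hp : 1 < p) (hsp : 0 < s * p) (hspN : s * p < N) :
    conjExp p * interpExp N s p (critExp N s p) = conjExp p - critExp N s p := by
  linear_combination -conjExp_mul_one_sub_interpExp hp hsp hspN

theorem conjExp_sub_critExp (N : ℕ) (s p : ℝ) :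
    conjExp p - critExp N s p = s * conjExp p / N := by
  unfold critExp
  ring

theorem pos_of_mul_pos_of_one_lt (hp : 1 < p) (hsp : 0 < s * p) : 0 < s :=
  pos_of_mul_pos_left hsp (by linarith)

theorem order_lt_dim (hp : 1 < p) (hsp : 0 < s * p) (hspN : s * p < N) : s < N := by
  nlinarith [pos_of_mul_pos_of_one_lt hp hsp]

end Exponents

/-! ### Scaling -/

theorem lintegral_comp_smul_RN {N : ℕ} (f : RN N → ℝ≥0∞) {t : ℝ} (ht : 0 < t) :
    ∫⁻ x, f (t • x) = ENNReal.ofReal (t ^ (-(N : ℝ))) * ∫⁻ x, f x := by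
  have h := Measure.map_addHaar_smul (volume : Measure (RN N)) ht.ne'
  have h2 := (Homeomorph.smulOfNeZero t ht.ne' :
    RN N ≃ₜ RN N).measurableEmbedding.lintegral_map f (μ := volume)
  have h3 : ((Homeomorph.smulOfNeZero t ht.ne' : RN N ≃ₜ RN N) : RN N → RN N) = (t • ·) := rfl
  rw [h3, h, lintegral_smul_measure] at h2
  rw [← h2, finrank_euclideanSpace, Fintype.card_fin, abs_of_pos (by positivity),
    Real.rpow_neg ht.le, Real.rpow_natCast, smul_eq_mul]

theorem rieszKernel_smul {N : ℕ} {s : ℝ} (x : RN N) {t : ℝ} (ht : 0 < t) :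
    rieszKernel N (s / 2) (t • x) = t ^ (s - N) * rieszKernel N (s / 2) x := by
  unfold rieszKernel
  rw [norm_smul, Real.norm_of_nonneg ht.le, Real.mul_rpow ht.le (norm_nonneg x),
    show 2 * (s / 2) - (N : ℝ) = s - N by ring]
  ring

/-- The function `x ↦ a ρ (t x)`. -/
def dilate {N : ℕ} (a t : ℝ) (ρ : RN N → ℝ) (x : RN N) : ℝ := a * ρ (t • x)

section Dilate

variable {N : ℕ} {a t : ℝ}

theorem rieszPotential_dilate {s : ℝ} (ha : 0 ≤ a) (ht : 0 < t) (ρ : RN N → ℝ) (x : RN N) :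
    rieszPotential N (s / 2) (dilate a t ρ) x =
      ENNReal.ofReal (a * t ^ (-s)) * rieszPotential N (s / 2) ρ (t • x) := by
  unfold rieszPotential
  set F : RN N → ℝ≥0∞ := fun z =>
    ENNReal.ofReal (rieszKernel N (s / 2) (t • x - z)) * ENNReal.ofReal (ρ z) with hF
  have hpos : 0 ≤ t ^ (N - s) := by positivity
  have h1 : ∀ y, ENNReal.ofReal (rieszKernel N (s / 2) (x - y)) *
      ENNReal.ofReal (dilate a t ρ y) = ENNReal.ofReal (a * t ^ (N - s)) * F (t • y) := by
    intro y
    have : rieszKernel N (s / 2) (x - y) = t ^ (N - s) * rieszKernel N (s / 2) (t • x - t • y) := by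
      rw [← smul_sub, rieszKernel_smul _ ht, ← mul_assoc, ← Real.rpow_add ht]
      simp
    rw [this, hF, dilate, ENNReal.ofReal_mul hpos, ENNReal.ofReal_mul ha, ENNReal.ofReal_mul ha]
    ring
  simp_rw [h1]
  rw [lintegral_const_mul' _ _ ENNReal.ofReal_ne_top, lintegral_comp_smul_RN F ht, ← mul_assoc,
    ← ENNReal.ofReal_mul (by positivity), mul_assoc a, ← Real.rpow_add ht]
  congr 4
  ring

theorem potentialPower_dilate {s p : ℝ} (hp : 1 < p) (ha : 0 ≤ a) (ht : 0 < t) (ρ : RN N → ℝ) :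
    potentialPower N s p (dilate a t ρ) =
      ENNReal.ofReal (a ^ conjExp p * t ^ (-(s * conjExp p) - N)) * potentialPower N s p ρ := by
  have hq : 0 < conjExp p := by linarith [one_lt_conjExp hp]
  unfold potentialPower
  simp_rw [rieszPotential_dilate ha ht]
  have h : ∀ x, (ENNReal.ofReal (a * t ^ (-s)) * rieszPotential N (s / 2) ρ (t • x)) ^ conjExp p =
      ENNReal.ofReal ((a * t ^ (-s)) ^ conjExp p) *
        rieszPotential N (s / 2) ρ (t • x) ^ conjExp p := by
    intro x
    rw [ENNReal.mul_rpow_of_nonneg _ _ hq.le, ENNReal.ofReal_rpow_of_nonneg (by positivity) hq.le]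
  simp_rw [h]
  rw [lintegral_const_mul' _ _ ENNReal.ofReal_ne_top,
    lintegral_comp_smul_RN (fun x => rieszPotential N (s / 2) ρ x ^ conjExp p) ht, ← mul_assoc,
    ← ENNReal.ofReal_mul (by positivity), Real.mul_rpow ha (by positivity), ← Real.rpow_mul ht.le,
    mul_assoc, ← Real.rpow_add ht]
  congr 4
  ring

theorem lintegral_dilate_rpow {m : ℝ} (hm : 0 ≤ m) (ha : 0 ≤ a) (ht : 0 < t) (ρ : RN N → ℝ) :
    ∫⁻ x, ENNReal.ofReal (dilate a t ρ x) ^ m =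
      ENNReal.ofReal (a ^ m * t ^ (-(N : ℝ))) * ∫⁻ x, ENNReal.ofReal (ρ x) ^ m := by
  have h : ∀ x, ENNReal.ofReal (dilate a t ρ x) ^ m =
      ENNReal.ofReal (a ^ m) * ENNReal.ofReal (ρ (t • x)) ^ m := by
    intro x
    rw [dilate, ENNReal.ofReal_mul ha, ENNReal.mul_rpow_of_nonneg _ _ hm,
      ENNReal.ofReal_rpow_of_nonneg ha hm]
  simp_rw [h]
  rw [lintegral_const_mul' _ _ ENNReal.ofReal_ne_top,
    lintegral_comp_smul_RN (fun x => ENNReal.ofReal (ρ x) ^ m) ht, ← mul_assoc,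
    ← ENNReal.ofReal_mul (by positivity)]

theorem lintegral_dilate (ha : 0 ≤ a) (ht : 0 < t) (ρ : RN N → ℝ) :
    ∫⁻ x, ENNReal.ofReal (dilate a t ρ x) =
      ENNReal.ofReal (a * t ^ (-(N : ℝ))) * ∫⁻ x, ENNReal.ofReal (ρ x) := by
  simpa using lintegral_dilate_rpow zero_le_one ha ht ρ

end Dilate

/-! ### General properties of the potential -/

section Potential

variable {N : ℕ} {s p : ℝ}

theorem rieszPotential_congr {ρ ρ' : RN N → ℝ} (h : ρ =ᵐ[volume] ρ') :
    rieszPotential N s ρ = rieszPotential N s ρ' := by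
  funext x
  refine lintegral_congr_ae ?_
  filter_upwards [h] with y hy
  rw [hy]

theorem potentialPower_congr {ρ ρ' : RN N → ℝ} (h : ρ =ᵐ[volume] ρ') :
    potentialPower N s p ρ = potentialPower N s p ρ' := by
  unfold potentialPower
  rw [rieszPotential_congr h]

theorem measurable_rieszPotential {ρ : RN N → ℝ} (hρ : AEMeasurable ρ) :
    Measurable (rieszPotential N s ρ) := by
  rw [rieszPotential_congr hρ.ae_eq_mk]
  have : Measurable (Function.uncurry fun x y : RN N =>
      ENNReal.ofReal (rieszKernel N s (x - y)) * ENNReal.ofReal (hρ.mk ρ y)) :=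
    ((measurable_rieszKernel N s).comp (measurable_fst.sub measurable_snd)).mul
      (hρ.measurable_mk.comp measurable_snd).ennreal_ofReal
  exact this.lintegral_prod_right'

theorem potentialPower_eq_zero (hp : 1 < p) {ρ : RN N → ℝ} (hρ : ρ =ᵐ[volume] 0) :
    potentialPower N s p ρ = 0 := by
  have hq : 0 < conjExp p := by linarith [one_lt_conjExp hp]
  rw [potentialPower_congr hρ]
  simp [potentialPower, rieszPotential, ENNReal.zero_rpow_of_pos hq]

/-- The kernel is positive off the origin, so only the zero function has zero potential. -/
theorem potentialPower_pos (hp : 1 < p) (hs : 0 < s) (hsN : s < N) {ρ : RN N → ℝ}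
    (hρ : AEMeasurable ρ) (h0 : 0 ≤ᵐ[volume] ρ) (hne : ¬ ρ =ᵐ[volume] 0) :
    0 < potentialPower N s p ρ := by
  have hN : 0 < N := by exact_mod_cast hs.trans hsN
  have : Nonempty (Fin N) := ⟨⟨0, hN⟩⟩
  have hq : 0 < conjExp p := by linarith [one_lt_conjExp hp]
  refine pos_iff_ne_zero.2 fun hP => hne ?_
  have h1 := (lintegral_eq_zero_iff ((measurable_rieszPotential hρ).pow_const _)).1 hP
  obtain ⟨x, hx⟩ := h1.exists
  have hx0 : rieszPotential N (s / 2) ρ x = 0 := by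
    simpa [ENNReal.rpow_eq_zero_iff_of_pos hq] using hx
  have hmeas : AEMeasurable fun y => ENNReal.ofReal (rieszKernel N (s / 2) (x - y)) *
      ENNReal.ofReal (ρ y) :=
    ((measurable_rieszKernel N (s / 2)).comp
      (measurable_const.sub measurable_id)).aemeasurable.mul hρ.ennreal_ofReal
  have h2 := (lintegral_eq_zero_iff' hmeas).1 hx0
  have h3 : ∀ᵐ y : RN N, y ≠ x := by
    rw [ae_iff]; simp
  filter_upwards [h2, h3, h0] with y hy hyx hy0
  have hK : 0 < rieszKernel N (s / 2) (x - y) :=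
    mul_pos (rieszConst_pos hs hsN)
      (Real.rpow_pos_of_pos (norm_pos_iff.2 (sub_ne_zero.2 hyx.symm)) _)
  have hz : ENNReal.ofReal (ρ y) = 0 := by
    rcases mul_eq_zero.1 hy with h | h
    · exact absurd (ENNReal.ofReal_eq_zero.1 h) (not_le.2 hK)
    · exact h
  exact le_antisymm (ENNReal.ofReal_eq_zero.1 hz) hy0

theorem potentialPower_translate (ρ : RN N → ℝ) (v : RN N) :
    potentialPower N s p (fun x => ρ (x + v)) = potentialPower N s p ρ := by
  have h : ∀ x, rieszPotential N (s / 2) (fun x => ρ (x + v)) x =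
      rieszPotential N (s / 2) ρ (x + v) := by
    intro x
    unfold rieszPotential
    rw [← lintegral_add_right_eq_self (fun y =>
      ENNReal.ofReal (rieszKernel N (s / 2) (x + v - y)) * ENNReal.ofReal (ρ y)) v]
    simp only [add_sub_add_right_eq_sub]
  unfold potentialPower
  simp_rw [h]
  exact lintegral_add_right_eq_self (fun x => rieszPotential N (s / 2) ρ x ^ conjExp p) v

theorem tendsto_potentialPower_indicator_ball (hp : 1 < p) {ρ : RN N → ℝ} (hρ : AEMeasurable ρ) :
    Filter.Tendsto
      (fun n : ℕ => potentialPower N s p ((Metric.ball (0 : RN N) n).indicator ρ))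
      Filter.atTop (nhds (potentialPower N s p ρ)) := by
  have hq : 0 < conjExp p := by linarith [one_lt_conjExp hp]
  have hρn : ∀ n : ℕ, AEMeasurable ((Metric.ball (0 : RN N) n).indicator ρ) := fun n =>
    hρ.indicator measurableSet_ball
  have hmono : ∀ y, Monotone fun n : ℕ =>
      ENNReal.ofReal ((Metric.ball (0 : RN N) n).indicator ρ y) := by
    intro y i j hij
    by_cases hi : y ∈ Metric.ball (0 : RN N) i
    · have hj : y ∈ Metric.ball (0 : RN N) j :=
        Metric.ball_subset_ball (by exact_mod_cast hij) hi
      simp [Set.indicator_of_mem hi, Set.indicator_of_mem hj]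
    · simp [Set.indicator_of_notMem hi]
  have hpmono : ∀ x, Monotone fun n : ℕ =>
      rieszPotential N (s / 2) ((Metric.ball (0 : RN N) n).indicator ρ) x := by
    intro x i j hij
    exact lintegral_mono fun y => mul_le_mul_right (hmono y hij) _
  refine lintegral_tendsto_of_tendsto_of_monotone
    (fun n => ((measurable_rieszPotential (hρn n)).pow_const _).aemeasurable)
    (Filter.Eventually.of_forall fun x i j hij =>
      ENNReal.rpow_le_rpow (hpmono x hij) hq.le) (Filter.Eventually.of_forall fun x => ?_)
  refine (ENNReal.continuous_rpow_const.tendsto _).comp ?_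
  refine lintegral_tendsto_of_tendsto_of_monotone (fun n => ?_)
    (Filter.Eventually.of_forall fun y i j hij => mul_le_mul_right (hmono y hij) _)
    (Filter.Eventually.of_forall fun y => ?_)
  · exact ((measurable_rieszKernel N (s / 2)).comp
      (measurable_const.sub measurable_id)).aemeasurable.mul (hρn n).ennreal_ofReal
  · refine tendsto_const_nhds.congr' ?_
    obtain ⟨n₀, hn₀⟩ := exists_nat_gt ‖y‖
    filter_upwards [Filter.eventually_ge_atTop n₀] with n hn
    have hy : y ∈ Metric.ball (0 : RN N) n := by
      rw [mem_ball_zero_iff]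
      exact hn₀.trans_le (by exact_mod_cast hn)
    rw [Set.indicator_of_mem hy]

end Potential

/-! ### The best constant at the critical exponent -/

section BestConst

variable {N : ℕ} {s p : ℝ}

theorem lintegral_ofReal_eq_eLpNorm_one {ρ : RN N → ℝ} (h0 : 0 ≤ᵐ[volume] ρ) :
    ∫⁻ x, ENNReal.ofReal (ρ x) = eLpNorm ρ 1 volume := by
  rw [eLpNorm_one_eq_lintegral_enorm]
  refine lintegral_congr_ae ?_
  filter_upwards [h0] with x hx
  rw [Real.enorm_of_nonneg hx]

theorem lintegral_ofReal_rpow_eq_eLpNorm_rpow {m : ℝ} (hm : 0 < m) {ρ : RN N → ℝ}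
    (h0 : 0 ≤ᵐ[volume] ρ) :
    ∫⁻ x, ENNReal.ofReal (ρ x) ^ m = eLpNorm ρ (ENNReal.ofReal m) volume ^ m := by
  rw [eLpNorm_eq_lintegral_rpow_enorm_toReal (by simpa using hm) ENNReal.ofReal_ne_top,
    ENNReal.toReal_ofReal hm.le, ← ENNReal.rpow_mul, one_div_mul_cancel hm.ne', ENNReal.rpow_one]
  refine lintegral_congr_ae ?_
  filter_upwards [h0] with x hx
  rw [Real.enorm_of_nonneg hx]

theorem lintegral_ofReal_ne_zero {ρ : RN N → ℝ} (hρ : AEStronglyMeasurable ρ)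
    (h0 : 0 ≤ᵐ[volume] ρ) (hne : ¬ ρ =ᵐ[volume] 0) : ∫⁻ x, ENNReal.ofReal (ρ x) ≠ 0 := by
  rw [lintegral_ofReal_eq_eLpNorm_one h0]
  exact fun h => hne ((eLpNorm_eq_zero_iff hρ one_ne_zero).1 h)

theorem lintegral_ofReal_rpow_ne_zero {m : ℝ} (hm : 0 < m) {ρ : RN N → ℝ}
    (hρ : AEStronglyMeasurable ρ) (h0 : 0 ≤ᵐ[volume] ρ) (hne : ¬ ρ =ᵐ[volume] 0) :
    ∫⁻ x, ENNReal.ofReal (ρ x) ^ m ≠ 0 := by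
  rw [lintegral_ofReal_rpow_eq_eLpNorm_rpow hm h0]
  intro h
  rw [ENNReal.rpow_eq_zero_iff_of_pos hm] at h
  exact hne ((eLpNorm_eq_zero_iff hρ (by simpa using hm)).1 h)

theorem lintegral_ofReal_lt_top {m : ℝ} {ρ : RN N → ℝ} (h : ρ ∈ nonnegL1Lm N m) :
    ∫⁻ x, ENNReal.ofReal (ρ x) < ⊤ := by
  rw [lintegral_ofReal_eq_eLpNorm_one h.1]
  exact (memLp_one_iff_integrable.2 h.2.1).2

theorem lintegral_ofReal_rpow_lt_top {m : ℝ} (hm : 0 < m) {ρ : RN N → ℝ}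
    (h : ρ ∈ nonnegL1Lm N m) : ∫⁻ x, ENNReal.ofReal (ρ x) ^ m < ⊤ := by
  rw [lintegral_ofReal_rpow_eq_eLpNorm_rpow hm h.1]
  exact ENNReal.rpow_lt_top_of_nonneg hm.le h.2.2.2.ne

/-- The scale invariant inequality, by dilating to unit mass and unit `L^m` norm. -/
theorem exists_potentialPower_le (hp : 1 < p) (hsp : 0 < s * p) (hspN : s * p < N) :
    ∃ C : ℝ≥0∞, C < ⊤ ∧ ∀ ρ ∈ nonnegL1Lm N (critExp N s p), ¬ ρ =ᵐ[volume] 0 →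
      potentialPower N s p ρ ≤
        C * ((∫⁻ x, ENNReal.ofReal (ρ x)) ^ (conjExp p - critExp N s p) *
          ∫⁻ x, ENNReal.ofReal (ρ x) ^ critExp N s p) := by
  have hs := pos_of_mul_pos_of_one_lt hp hsp
  have hsN := order_lt_dim hp hsp hspN
  have hm := one_lt_critExp hp hsp hspN
  have hNpos : (0 : ℝ) < N := hsp.trans hspN
  have hmq := critExp_eq N s p
  have hsub := conjExp_sub_critExp N s p
  obtain ⟨C, hC, hCle⟩ := exists_lintegral_rieszKernel_rpow_le hs hsN hm hmq
  refine ⟨C, hC, fun ρ hρ hne => ?_⟩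
  set m := critExp N s p
  set q := conjExp p with hq
  have hm0 : 0 < m := by linarith
  have hJ1 : ∫⁻ x, ENNReal.ofReal (ρ x) = ENNReal.ofReal (∫⁻ x, ENNReal.ofReal (ρ x)).toReal :=
    (ENNReal.ofReal_toReal (lintegral_ofReal_lt_top hρ).ne).symm
  have hJm : ∫⁻ x, ENNReal.ofReal (ρ x) ^ m =
      ENNReal.ofReal (∫⁻ x, ENNReal.ofReal (ρ x) ^ m).toReal :=
    (ENNReal.ofReal_toReal (lintegral_ofReal_rpow_lt_top hm0 hρ).ne).symm
  have hj1 : 0 < (∫⁻ x, ENNReal.ofReal (ρ x)).toReal :=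
    ENNReal.toReal_pos (lintegral_ofReal_ne_zero hρ.2.1.1 hρ.1 hne)
      (lintegral_ofReal_lt_top hρ).ne
  have hjm : 0 < (∫⁻ x, ENNReal.ofReal (ρ x) ^ m).toReal :=
    ENNReal.toReal_pos (lintegral_ofReal_rpow_ne_zero hm0 hρ.2.1.1 hρ.1 hne)
      (lintegral_ofReal_rpow_lt_top hm0 hρ).ne
  set j₁ := (∫⁻ x, ENNReal.ofReal (ρ x)).toReal
  set jₘ := (∫⁻ x, ENNReal.ofReal (ρ x) ^ m).toReal
  -- `t` is chosen so that `t ^ (N (m - 1)) = j₁ ^ m / jₘ`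
  set r := j₁ ^ m / jₘ with hr
  have hr0 : 0 < r := by positivity
  set t := r ^ (1 / (N * (m - 1))) with ht
  have ht0 : 0 < t := Real.rpow_pos_of_pos hr0 _
  have hNm : 0 < N * (m - 1) := mul_pos hNpos (by linarith)
  have htr : t ^ (N * (m - 1)) = r := by
    rw [ht, ← Real.rpow_mul hr0.le, one_div_mul_cancel hNm.ne', Real.rpow_one]
  set a := t ^ (N : ℝ) / j₁ with ha
  have ha0 : 0 < a := by positivity
  have htN : t ^ (N : ℝ) * t ^ (-(N : ℝ)) = 1 := by rw [← Real.rpow_add ht0]; simp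
  have n1 : a * t ^ (-(N : ℝ)) * j₁ = 1 := by
    rw [ha]; field_simp; exact htN
  have nm : a ^ m * t ^ (-(N : ℝ)) * jₘ = 1 := by
    rw [ha, Real.div_rpow (by positivity) hj1.le, ← Real.rpow_mul ht0.le]
    have : t ^ (N * m) * t ^ (-(N : ℝ)) = r := by
      rw [← htr, ← Real.rpow_add ht0]; congr 1; ring
    calc t ^ (N * m) / j₁ ^ m * t ^ (-(N : ℝ)) * jₘ
        = (t ^ (N * m) * t ^ (-(N : ℝ))) / j₁ ^ m * jₘ := by ring
      _ = 1 := by rw [this, hr]; field_simp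
  set g := hρ.2.1.1.aemeasurable.mk ρ
  have hg : Measurable g := hρ.2.1.1.aemeasurable.measurable_mk
  have hρg : ρ =ᵐ[volume] g := hρ.2.1.1.aemeasurable.ae_eq_mk
  have hg1 : ∫⁻ x, ENNReal.ofReal (g x) = ENNReal.ofReal j₁ := by
    rw [← hJ1]
    refine lintegral_congr_ae ?_
    filter_upwards [hρg] with x hx
    rw [hx]
  have hgm : ∫⁻ x, ENNReal.ofReal (g x) ^ m = ENNReal.ofReal jₘ := by
    rw [← hJm]
    refine lintegral_congr_ae ?_
    filter_upwards [hρg] with x hx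
    rw [hx]
  have hdm : Measurable fun x => ENNReal.ofReal (dilate a t g x) := by
    unfold dilate
    fun_prop
  have hbound := hCle _ hdm
    (by rw [lintegral_dilate ha0.le ht0, hg1, ← ENNReal.ofReal_mul (by positivity), n1,
      ENNReal.ofReal_one])
    (by rw [lintegral_dilate_rpow hm0.le ha0.le ht0, hgm, ← ENNReal.ofReal_mul (by positivity), nm,
      ENNReal.ofReal_one])
  change potentialPower N s p (dilate a t g) ≤ C at hbound
  rw [potentialPower_dilate hp ha0.le ht0, ← hq, ← potentialPower_congr hρg] at hbound
  have hfac : a ^ q * t ^ (-(s * q) - N) * (j₁ ^ (q - m) * jₘ) = 1 := by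
    rw [ha, Real.div_rpow (by positivity) hj1.le, ← Real.rpow_mul ht0.le]
    have e1 : t ^ (N * q) * t ^ (-(s * q) - N) = r := by
      rw [← htr, ← Real.rpow_add ht0]
      congr 1
      rw [hmq]; field_simp; ring
    have e2 : j₁ ^ (q - m) = j₁ ^ q / j₁ ^ m := Real.rpow_sub hj1 _ _
    calc t ^ (N * q) / j₁ ^ q * t ^ (-(s * q) - N) * (j₁ ^ (q - m) * jₘ)
        = (t ^ (N * q) * t ^ (-(s * q) - N)) / j₁ ^ q * (j₁ ^ (q - m) * jₘ) := by ring
      _ = 1 := by rw [e1, e2, hr]; field_simp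
  have hqm : 0 ≤ q - m := by rw [hsub]; have := one_lt_conjExp hp; positivity
  rw [hJ1, hJm, ENNReal.ofReal_rpow_of_nonneg hj1.le hqm, ← ENNReal.ofReal_mul (by positivity)]
  calc potentialPower N s p ρ
      = ENNReal.ofReal (a ^ q * t ^ (-(s * q) - N) * (j₁ ^ (q - m) * jₘ)) *
          potentialPower N s p ρ := by rw [hfac, ENNReal.ofReal_one, one_mul]
    _ = ENNReal.ofReal (a ^ q * t ^ (-(s * q) - N)) * potentialPower N s p ρ *
          ENNReal.ofReal (j₁ ^ (q - m) * jₘ) := by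
        rw [ENNReal.ofReal_mul (by positivity)]; ring
    _ ≤ _ := by gcongr

/-- The denominator in the definition of the best constant, written with integrals. -/
theorem eLpNorm_mul_eLpNorm_eq (hp : 1 < p) (hsp : 0 < s * p) (hspN : s * p < N)
    {h : RN N → ℝ} (h0 : 0 ≤ᵐ[volume] h) :
    eLpNorm h 1 volume ^ (conjExp p * interpExp N s p (critExp N s p)) *
        eLpNorm h (ENNReal.ofReal (critExp N s p)) volume ^
          (conjExp p * (1 - interpExp N s p (critExp N s p))) =
      (∫⁻ x, ENNReal.ofReal (h x)) ^ (conjExp p - critExp N s p) *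
        ∫⁻ x, ENNReal.ofReal (h x) ^ critExp N s p := by
  have hm := one_lt_critExp hp hsp hspN
  rw [conjExp_mul_one_sub_interpExp hp hsp hspN, conjExp_mul_interpExp hp hsp hspN,
    lintegral_ofReal_eq_eLpNorm_one h0, lintegral_ofReal_rpow_eq_eLpNorm_rpow (by linarith) h0]

theorem hls_denominator_ne_zero (hp : 1 < p) (hsp : 0 < s * p) (hspN : s * p < N)
    {h : RN N → ℝ} (hh : h ∈ nonnegL1Lm N (critExp N s p)) (hne : ¬ h =ᵐ[volume] 0) :
    (∫⁻ x, ENNReal.ofReal (h x)) ^ (conjExp p - critExp N s p) *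
        ∫⁻ x, ENNReal.ofReal (h x) ^ critExp N s p ≠ 0 := by
  have hm := one_lt_critExp hp hsp hspN
  refine mul_ne_zero (fun h' => ?_)
    (lintegral_ofReal_rpow_ne_zero (by linarith) hh.2.1.1 hh.1 hne)
  rcases ENNReal.rpow_eq_zero_iff.1 h' with h' | h'
  · exact lintegral_ofReal_ne_zero hh.2.1.1 hh.1 hne h'.1
  · exact (lintegral_ofReal_lt_top hh).ne h'.1

theorem hls_denominator_ne_top (hp : 1 < p) (hsp : 0 < s * p) (hspN : s * p < N)
    {h : RN N → ℝ} (hh : h ∈ nonnegL1Lm N (critExp N s p)) :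
    (∫⁻ x, ENNReal.ofReal (h x)) ^ (conjExp p - critExp N s p) *
        ∫⁻ x, ENNReal.ofReal (h x) ^ critExp N s p ≠ ⊤ := by
  have hm := one_lt_critExp hp hsp hspN
  have hs := pos_of_mul_pos_of_one_lt hp hsp
  have hq := one_lt_conjExp hp
  refine ENNReal.mul_ne_top (ENNReal.rpow_ne_top_of_nonneg ?_ (lintegral_ofReal_lt_top hh).ne)
    (lintegral_ofReal_rpow_lt_top (by linarith) hh).ne
  rw [conjExp_sub_critExp]
  positivity

theorem hlsBestConst_lt_top (hp : 1 < p) (hsp : 0 < s * p) (hspN : s * p < N) :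
    hlsBestConst N s p (critExp N s p) < ⊤ := by
  obtain ⟨C, hC, hle⟩ := exists_potentialPower_le hp hsp hspN
  refine lt_of_le_of_lt (iSup₂_le fun h hh => ?_) hC
  rw [eLpNorm_mul_eLpNorm_eq hp hsp hspN hh.1.1]
  exact ENNReal.div_le_of_le_mul (hle h hh.1 hh.2)

theorem potentialPower_le_hlsBestConst (hp : 1 < p) (hsp : 0 < s * p) (hspN : s * p < N)
    {h : RN N → ℝ} (hh : h ∈ nonnegL1Lm N (critExp N s p)) :
    potentialPower N s p h ≤ hlsBestConst N s p (critExp N s p) *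
      ((∫⁻ x, ENNReal.ofReal (h x)) ^ (conjExp p - critExp N s p) *
        ∫⁻ x, ENNReal.ofReal (h x) ^ critExp N s p) := by
  by_cases hne : h =ᵐ[volume] 0
  · simp [potentialPower_eq_zero hp hne]
  · rw [← ENNReal.div_le_iff (hls_denominator_ne_zero hp hsp hspN hh hne)
      (hls_denominator_ne_top hp hsp hspN hh), ← eLpNorm_mul_eLpNorm_eq hp hsp hspN hh.1]
    exact le_iSup₂_of_le (f := fun h (_ : h ∈ {h : RN N → ℝ | h ∈ nonnegL1Lm N (critExp N s p) ∧
      ¬ h =ᵐ[volume] 0}) => potentialPower N s p h /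
      (eLpNorm h 1 volume ^ (conjExp p * interpExp N s p (critExp N s p)) *
        eLpNorm h (ENNReal.ofReal (critExp N s p)) volume ^
          (conjExp p * (1 - interpExp N s p (critExp N s p))))) h ⟨hh, hne⟩ le_rfl

theorem potentialPower_lt_top (hp : 1 < p) (hsp : 0 < s * p) (hspN : s * p < N)
    {h : RN N → ℝ} (hh : h ∈ nonnegL1Lm N (critExp N s p)) : potentialPower N s p h < ⊤ :=
  (potentialPower_le_hlsBestConst hp hsp hspN hh).trans_lt
    (ENNReal.mul_lt_top (hlsBestConst_lt_top hp hsp hspN)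
      (hls_denominator_ne_top hp hsp hspN hh).lt_top)

theorem hlsBestConst_pos_of_mem (hp : 1 < p) (hsp : 0 < s * p) (hspN : s * p < N)
    {h : RN N → ℝ} (hh : h ∈ nonnegL1Lm N (critExp N s p)) (hne : ¬ h =ᵐ[volume] 0) :
    0 < hlsBestConst N s p (critExp N s p) := by
  refine pos_iff_ne_zero.2 fun h0 => ?_
  have h1 := potentialPower_le_hlsBestConst hp hsp hspN hh
  rw [h0, zero_mul] at h1
  exact (potentialPower_pos hp (pos_of_mul_pos_of_one_lt hp hsp) (order_lt_dim hp hsp hspN)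
    hh.2.1.1.aemeasurable hh.1 hne).not_ge h1

theorem exists_lt_potentialPower (hp : 1 < p) (hsp : 0 < s * p) (hspN : s * p < N) {c : ℝ≥0∞}
    (hc : c < hlsBestConst N s p (critExp N s p)) :
    ∃ h ∈ nonnegL1Lm N (critExp N s p),
      c * ((∫⁻ x, ENNReal.ofReal (h x)) ^ (conjExp p - critExp N s p) *
        ∫⁻ x, ENNReal.ofReal (h x) ^ critExp N s p) < potentialPower N s p h := by
  obtain ⟨h, hc⟩ := lt_iSup_iff.1 hc
  obtain ⟨hh, hc⟩ := lt_iSup_iff.1 hc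
  rw [eLpNorm_mul_eLpNorm_eq hp hsp hspN hh.1.1] at hc
  exact ⟨h, hh.1, (ENNReal.lt_div_iff_mul_lt
    (Or.inl (hls_denominator_ne_zero hp hsp hspN hh.1 hh.2))
    (Or.inl (hls_denominator_ne_top hp hsp hspN hh.1))).1 hc⟩

end BestConst

/-! ### Admissible densities -/

section Admissible

variable {N : ℕ} {m M : ℝ}

theorem map_smul_volume_RN {t : ℝ} (ht : 0 < t) :
    Measure.map (t • · : RN N → RN N) volume =
      ENNReal.ofReal |(t ^ N)⁻¹| • (volume : Measure (RN N)) := by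
  simpa using Measure.map_addHaar_smul (volume : Measure (RN N)) ht.ne'

theorem dilate_mem_nonnegL1Lm {a t : ℝ} (ha : 0 < a) (ht : 0 < t) {ρ : RN N → ℝ}
    (hρ : ρ ∈ nonnegL1Lm N m) : dilate a t ρ ∈ nonnegL1Lm N m := by
  have hemb : MeasurableEmbedding (t • · : RN N → RN N) :=
    (Homeomorph.smulOfNeZero t ht.ne' : RN N ≃ₜ RN N).measurableEmbedding
  refine ⟨?_, ((integrable_comp_smul_iff volume ρ ht.ne').2 hρ.2.1).const_mul a, ?_⟩
  · have h : ∀ᵐ y ∂Measure.map (t • · : RN N → RN N) volume, 0 ≤ ρ y := by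
      rw [map_smul_volume_RN ht]
      exact Measure.ae_smul_measure hρ.1 _
    filter_upwards [ae_of_ae_map hemb.measurable.aemeasurable h] with x hx
    exact mul_nonneg ha.le hx
  · have h : MemLp ρ (ENNReal.ofReal m) (Measure.map (t • · : RN N → RN N) volume) := by
      rw [map_smul_volume_RN ht]
      exact hρ.2.2.smul_measure ENNReal.ofReal_ne_top
    exact (hemb.memLp_map_measure_iff.1 h).const_mul a

theorem dilate_mem_massClass {a t : ℝ} (ha : 0 < a) (ht : 0 < t) {ρ : RN N → ℝ}
    (hρ : ρ ∈ massClass N m M) : dilate a t ρ ∈ massClass N m (a * t ^ (-(N : ℝ)) * M) := by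
  have h : (fun x => dilate a t ρ x • x) =
      fun x => (fun y => (a * t⁻¹) • ρ y • y) (t • x) := by
    funext x
    simp only [dilate, smul_smul]
    congr 1
    field_simp
  refine ⟨dilate_mem_nonnegL1Lm ha ht hρ.1, ?_, ?_, ?_⟩
  · rw [h]
    exact (integrable_comp_smul_iff volume (fun y => (a * t⁻¹) • ρ y • y) ht.ne').2
      (hρ.2.1.smul (a * t⁻¹))
  · rw [h, Measure.integral_comp_smul volume (fun y => (a * t⁻¹) • ρ y • y), integral_smul,
      hρ.2.2.1, smul_zero, smul_zero]
  · unfold dilate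
    rw [integral_const_mul, Measure.integral_comp_smul, hρ.2.2.2, finrank_euclideanSpace,
      Fintype.card_fin, abs_of_pos (by positivity), Real.rpow_neg ht.le, Real.rpow_natCast,
      smul_eq_mul, mul_assoc]

theorem dilate_mass_preserving {t : ℝ} (ht : 0 < t) {ρ : RN N → ℝ} (hρ : ρ ∈ massClass N m M) :
    dilate (t ^ (N : ℝ)) t ρ ∈ massClass N m M := by
  have h := dilate_mem_massClass (Real.rpow_pos_of_pos ht N) ht hρ
  rwa [← Real.rpow_add ht, add_neg_cancel, Real.rpow_zero, one_mul] at h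

theorem lintegral_ofReal_of_mem_massClass {ρ : RN N → ℝ} (hρ : ρ ∈ massClass N m M) :
    ∫⁻ x, ENNReal.ofReal (ρ x) = ENNReal.ofReal M := by
  rw [← hρ.2.2.2, ofReal_integral_eq_lintegral_ofReal hρ.1.2.1 hρ.1.1]

theorem not_ae_eq_zero_of_mem_massClass (hM : 0 < M) {ρ : RN N → ℝ} (hρ : ρ ∈ massClass N m M) :
    ¬ ρ =ᵐ[volume] 0 := by
  intro h
  have h1 := hρ.2.2.2
  rw [integral_congr_ae h] at h1
  simp at h1
  linarith

/-- A multiple of the indicator of the unit ball. -/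
theorem exists_forall_mem_massClass (hM : 0 < M) :
    ∃ ρ : RN N → ℝ, ∀ m, ρ ∈ massClass N m M := by
  set B := Metric.ball (0 : RN N) 1 with hB
  have hBfin : volume B ≠ ⊤ := measure_ball_lt_top.ne
  have hBpos : 0 < volume.real B :=
    ENNReal.toReal_pos (Metric.measure_ball_pos volume _ one_pos).ne' hBfin
  set c := M / volume.real B with hc
  have hc0 : 0 ≤ c := by positivity
  set ρ : RN N → ℝ := B.indicator fun _ => c with hρ
  have hint : Integrable ρ := (integrable_indicator_iff measurableSet_ball).2
    (integrableOn_const hBfin)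
  refine ⟨ρ, fun m => ⟨⟨Filter.Eventually.of_forall fun x =>
    Set.indicator_nonneg (fun _ _ => hc0) x, hint, memLp_indicator_const _ measurableSet_ball _
      (Or.inr hBfin)⟩, ?_, ?_, ?_⟩⟩
  · refine hint.mono (hint.1.smul measurable_id.aestronglyMeasurable)
      (Filter.Eventually.of_forall fun x => ?_)
    rw [norm_smul]
    by_cases hx : x ∈ B
    · exact mul_le_of_le_one_right (norm_nonneg _) (mem_ball_zero_iff.1 hx).le
    · simp [hρ, Set.indicator_of_notMem hx]
  · -- the integrand is odd
    have hodd : ∀ x, ρ (-x) • (-x) = -(ρ x • x) := by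
      intro x
      have : ρ (-x) = ρ x := by
        simp only [hρ, Set.indicator, hB, mem_ball_zero_iff, norm_neg]
      rw [this, smul_neg]
    have h := integral_neg_eq_self (fun x : RN N => ρ x • x) volume
    simp_rw [hodd, integral_neg] at h
    have h2 : (2 : ℝ) • ∫ x, ρ x • x = 0 := by
      rw [two_smul]
      exact eq_neg_iff_add_eq_zero.1 h.symm
    exact (smul_eq_zero.1 h2).resolve_left two_ne_zero
  · rw [hρ, integral_indicator measurableSet_ball, setIntegral_const, smul_eq_mul, hc,
      mul_div_cancel₀ _ hBpos.ne']

theorem translate_mem_massClass {h : RN N → ℝ} (hh : h ∈ nonnegL1Lm N m)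
    (hx : Integrable fun x => h x • x) (h0 : ∫ x, h x ≠ 0) :
    (fun x => h (x + (∫ x, h x)⁻¹ • ∫ x, h x • x)) ∈ massClass N m (∫ x, h x) := by
  set v := (∫ x, h x)⁻¹ • ∫ x, h x • x with hv
  have hmp := measurePreserving_add_right (volume : Measure (RN N)) v
  have he : (fun x => h (x + v) • x) = fun x => (fun y => h y • y - h y • v) (x + v) := by
    funext x
    simp only [← smul_sub, add_sub_cancel_right]
  have hint : Integrable fun y => h y • y - h y • v := hx.sub (hh.2.1.smul_const v)
  refine ⟨⟨hmp.quasiMeasurePreserving.ae hh.1, hh.2.1.comp_add_right v,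
    hh.2.2.comp_measurePreserving hmp⟩, ?_, ?_, integral_add_right_eq_self h v⟩
  · rw [he]
    exact hint.comp_add_right v
  · rw [he, integral_add_right_eq_self (fun y => h y • y - h y • v) v,
      integral_sub hx (hh.2.1.smul_const v), integral_smul_const, hv, smul_smul,
      mul_inv_cancel₀ h0, one_smul, sub_self]

end Admissible

section NearOptimal

variable {N : ℕ} {s p : ℝ}

/-- The supremum defining the best constant may be taken over centred densities of given mass:
truncation gives a finite first moment, after which translation and multiplication by a constant
do not change the quotient. -/
theorem exists_mem_massClass_lt_potentialPower (hp : 1 < p) (hsp : 0 < s * p)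
    (hspN : s * p < N) {M : ℝ} (hM : 0 < M) {c : ℝ≥0∞}
    (hc : c < hlsBestConst N s p (critExp N s p)) :
    ∃ ρ ∈ massClass N (critExp N s p) M,
      c * (ENNReal.ofReal M ^ (conjExp p - critExp N s p) *
        ∫⁻ x, ENNReal.ofReal (ρ x) ^ critExp N s p) < potentialPower N s p ρ := by
  obtain ⟨h, hh, hlt⟩ := exists_lt_potentialPower hp hsp hspN hc
  have hsub := conjExp_sub_critExp N s p
  have hs := pos_of_mul_pos_of_one_lt hp hsp
  have hq := one_lt_conjExp hp
  have hm := one_lt_critExp hp hsp hspN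
  set m := critExp N s p
  set q := conjExp p with hqdef
  have hqm : 0 ≤ q - m := by rw [hsub]; positivity
  obtain ⟨n, hn⟩ := ((tendsto_potentialPower_indicator_ball hp
    hh.2.1.1.aemeasurable).eventually (lt_mem_nhds hlt)).exists
  set k := (Metric.ball (0 : RN N) n).indicator h with hk
  have hkle : ∀ x, ENNReal.ofReal (k x) ≤ ENNReal.ofReal (h x) := by
    intro x
    by_cases hx : x ∈ Metric.ball (0 : RN N) n
    · rw [hk, Set.indicator_of_mem hx]
    · simp [hk, Set.indicator_of_notMem hx]
  have hkmem : k ∈ nonnegL1Lm N m := by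
    refine ⟨?_, hh.2.1.indicator measurableSet_ball, hh.2.2.indicator measurableSet_ball⟩
    filter_upwards [hh.1] with x hx
    exact Set.indicator_apply_nonneg fun _ => hx
  have hkx : Integrable fun x => k x • x := by
    refine (hkmem.2.1.smul (n : ℝ)).mono (hkmem.2.1.1.smul measurable_id.aestronglyMeasurable)
      (Filter.Eventually.of_forall fun x => ?_)
    rw [Pi.smul_apply, norm_smul, smul_eq_mul, norm_mul, mul_comm]
    by_cases hx : x ∈ Metric.ball (0 : RN N) n
    · have : ‖id x‖ ≤ ‖(n : ℝ)‖ := by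
        rw [Real.norm_of_nonneg n.cast_nonneg]
        exact (mem_ball_zero_iff.1 hx).le
      gcongr
      exact this
    · simp [hk, Set.indicator_of_notMem hx]
  have hlt' : c * ((∫⁻ x, ENNReal.ofReal (k x)) ^ (q - m) *
      ∫⁻ x, ENNReal.ofReal (k x) ^ m) < potentialPower N s p k := by
    refine lt_of_le_of_lt ?_ hn
    gcongr c * (?_ ^ _ * ?_)
    · exact lintegral_mono hkle
    · exact lintegral_mono fun x => ENNReal.rpow_le_rpow (hkle x) (by linarith)
  have hkne : ¬ k =ᵐ[volume] 0 := fun h0 => by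
    rw [potentialPower_eq_zero hp h0] at hlt'
    exact not_lt_zero hlt'
  have hj : 0 < ∫ x, k x := by
    refine lt_of_le_of_ne (integral_nonneg_of_ae hkmem.1) fun h0 => hkne ?_
    exact (integral_eq_zero_iff_of_nonneg_ae hkmem.1 hkmem.2.1).1 h0.symm
  set j := ∫ x, k x with hjdef
  set v := j⁻¹ • ∫ x, k x • x with hv
  have hmem : (fun x => k (x + v)) ∈ massClass N m j := translate_mem_massClass hkmem hkx hj.ne'
  have ha : 0 < M / j := by positivity
  have hmem' := dilate_mem_massClass ha one_pos hmem
  rw [Real.one_rpow, mul_one, div_mul_cancel₀ _ hj.ne'] at hmem'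
  refine ⟨_, hmem', ?_⟩
  rw [potentialPower_dilate hp ha.le one_pos, potentialPower_translate,
    lintegral_dilate_rpow (by linarith) ha.le one_pos, Real.one_rpow, Real.one_rpow, mul_one,
    mul_one, lintegral_add_right_eq_self (fun x => ENNReal.ofReal (k x) ^ m) v]
  have hk1 : ∫⁻ x, ENNReal.ofReal (k x) = ENNReal.ofReal j :=
    (ofReal_integral_eq_lintegral_ofReal hkmem.2.1 hkmem.1).symm
  rw [hk1] at hlt'
  have hMj : ENNReal.ofReal M ^ (q - m) * ENNReal.ofReal ((M / j) ^ m) =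
      ENNReal.ofReal ((M / j) ^ q) * ENNReal.ofReal j ^ (q - m) := by
    rw [ENNReal.ofReal_rpow_of_pos hM, ENNReal.ofReal_rpow_of_pos hj,
      ← ENNReal.ofReal_mul (by positivity), ← ENNReal.ofReal_mul (by positivity)]
    congr 1
    rw [Real.div_rpow hM.le hj.le, Real.div_rpow hM.le hj.le, Real.rpow_sub hM, Real.rpow_sub hj]
    field_simp
  calc c * (ENNReal.ofReal M ^ (q - m) *
        (ENNReal.ofReal ((M / j) ^ m) * ∫⁻ x, ENNReal.ofReal (k x) ^ m))
      = c * ((ENNReal.ofReal M ^ (q - m) * ENNReal.ofReal ((M / j) ^ m)) *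
          ∫⁻ x, ENNReal.ofReal (k x) ^ m) := by ring
    _ = ENNReal.ofReal ((M / j) ^ q) *
          (c * (ENNReal.ofReal j ^ (q - m) * ∫⁻ x, ENNReal.ofReal (k x) ^ m)) := by
        rw [hMj]; ring
    _ < ENNReal.ofReal ((M / j) ^ q) * potentialPower N s p k :=
        ENNReal.mul_lt_mul_right (by simpa using Real.rpow_pos_of_pos ha q)
          ENNReal.ofReal_ne_top hlt'

end NearOptimal

/-! ### The free energy along mass preserving dilations -/

section FreeEnergy

variable {N : ℕ} {s p χ m M : ℝ}

theorem freeEnergy_eq_coe (hp : 1 < p) (hχ : 0 < χ) (hm : 1 < m) {ρ : RN N → ℝ} {A B : ℝ}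
    (hA0 : 0 ≤ A) (hB0 : 0 ≤ B)
    (hA : ∫⁻ x, ENNReal.ofReal (ρ x) ^ m = ENNReal.ofReal A)
    (hB : potentialPower N s p ρ = ENNReal.ofReal B) :
    freeEnergy N s p χ m ρ = ((1 / (m - 1) * A - χ * (1 / conjExp p * B) : ℝ) : EReal) := by
  have hq := one_lt_conjExp hp
  have hm1 : 0 ≤ 1 / (m - 1) := one_div_nonneg.2 (by linarith)
  unfold freeEnergy spEnergy
  rw [hA, hB, ← ENNReal.ofReal_mul hm1, ← ENNReal.ofReal_mul (by positivity),
    ← ENNReal.ofReal_mul hχ.le, EReal.coe_ennreal_ofReal, EReal.coe_ennreal_ofReal,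
    max_eq_left (by positivity), max_eq_left (by positivity), EReal.coe_sub]

theorem lintegral_dilate_mass_preserving_rpow (hm : 1 < m) {t : ℝ} (ht : 0 < t) {ρ : RN N → ℝ}
    {A : ℝ} (hA : ∫⁻ x, ENNReal.ofReal (ρ x) ^ m = ENNReal.ofReal A) :
    ∫⁻ x, ENNReal.ofReal (dilate (t ^ (N : ℝ)) t ρ x) ^ m =
      ENNReal.ofReal (t ^ (N * (m - 1)) * A) := by
  rw [lintegral_dilate_rpow (by linarith) (by positivity) ht, hA,
    ← ENNReal.ofReal_mul (by positivity), ← Real.rpow_mul ht.le, ← Real.rpow_add ht]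
  congr 3
  ring

theorem potentialPower_dilate_mass_preserving (hp : 1 < p) (hN : (0 : ℝ) < N) {t : ℝ} (ht : 0 < t)
    {ρ : RN N → ℝ} {B : ℝ} (hB : potentialPower N s p ρ = ENNReal.ofReal B) :
    potentialPower N s p (dilate (t ^ (N : ℝ)) t ρ) =
      ENNReal.ofReal (t ^ (N * (critExp N s p - 1)) * B) := by
  rw [potentialPower_dilate hp (by positivity) ht, hB,
    ← ENNReal.ofReal_mul (by positivity), ← Real.rpow_mul ht.le, ← Real.rpow_add ht]
  congr 3
  rw [critExp_eq]
  field_simp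
  ring

/-- Mass preserving dilations scale the two parts of the free energy by `t ^ (N (m - 1))` and
`t ^ (N (m_c - 1))`. -/
theorem infEnergy_le_dilate (hp : 1 < p) (hN : (0 : ℝ) < N) (hχ : 0 < χ) (hm : 1 < m)
    {ρ : RN N → ℝ} (hρ : ρ ∈ massClass N m M) {A B : ℝ} (hA0 : 0 ≤ A) (hB0 : 0 ≤ B)
    (hA : ∫⁻ x, ENNReal.ofReal (ρ x) ^ m = ENNReal.ofReal A)
    (hB : potentialPower N s p ρ = ENNReal.ofReal B) {t : ℝ} (ht : 0 < t) :
    infEnergy N s p χ m M ≤ ((t ^ (N * (m - 1)) * (1 / (m - 1) * A) -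
      t ^ (N * (critExp N s p - 1)) * (χ * (1 / conjExp p * B)) : ℝ) : EReal) := by
  refine (iInf₂_le _ (dilate_mass_preserving ht hρ)).trans_eq ?_
  rw [freeEnergy_eq_coe hp hχ hm (by positivity) (by positivity)
    (lintegral_dilate_mass_preserving_rpow hm ht hA)
    (potentialPower_dilate_mass_preserving hp hN ht hB)]
  congr 1
  ring

theorem eq_bot_of_forall_le_coe_of_tendsto {x : EReal} {f : ℝ → ℝ}
    (h : ∀ t, 0 < t → x ≤ (f t : EReal)) (hf : Filter.Tendsto f Filter.atTop Filter.atBot) :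
    x = ⊥ := by
  rw [EReal.eq_bot_iff_forall_lt]
  intro y
  obtain ⟨t, hty, ht0⟩ :=
    ((hf.eventually (Filter.eventually_lt_atBot y)).and (Filter.eventually_gt_atTop 0)).exists
  exact (h t ht0).trans_lt (by exact_mod_cast hty)

theorem tendsto_rpow_mul_sub_rpow_mul_atBot {a b α β : ℝ} (hab : a < b) (hb : 0 < b)
    (hβ : 0 < β) :
    Filter.Tendsto (fun t : ℝ => t ^ a * α - t ^ b * β) Filter.atTop Filter.atBot := by
  have h1 : Filter.Tendsto (fun t : ℝ => t ^ (-(b - a)) * α - β) Filter.atTop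
      (nhds (0 * α - β)) :=
    ((tendsto_rpow_neg_atTop (sub_pos.2 hab)).mul_const α).sub_const β
  have h2 := (tendsto_rpow_atTop hb).atTop_mul_neg (by linarith : 0 * α - β < 0) h1
  refine h2.congr' ?_
  filter_upwards [Filter.eventually_gt_atTop 0] with t ht
  rw [mul_sub, ← mul_assoc, ← Real.rpow_add ht]
  congr 3
  ring

theorem exists_pos_rpow_mul_lt {a α β : ℝ} (ha : 0 < a) (hα : 0 ≤ α) (hβ : 0 < β) :
    ∃ t : ℝ, 0 < t ∧ t ^ a * α < β := by
  have hr : 0 < β / (α + 1) := by positivity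
  refine ⟨(β / (α + 1)) ^ (1 / a), Real.rpow_pos_of_pos hr _, ?_⟩
  rw [← Real.rpow_mul hr.le, one_div_mul_cancel ha.ne', Real.rpow_one, div_mul_eq_mul_div,
    div_lt_iff₀ (by positivity)]
  nlinarith

end FreeEnergy

/-! ### The three regimes -/

section Regimes

variable {N : ℕ} {s p χ m M : ℝ}

theorem exists_real_potentialPower (hp : 1 < p) (hsp : 0 < s * p) (hspN : s * p < N)
    {ρ : RN N → ℝ} (hρ : ρ ∈ nonnegL1Lm N (critExp N s p)) (hne : ¬ ρ =ᵐ[volume] 0) :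
    ∃ B : ℝ, 0 < B ∧ potentialPower N s p ρ = ENNReal.ofReal B :=
  ⟨_, ENNReal.toReal_pos (potentialPower_pos hp (pos_of_mul_pos_of_one_lt hp hsp)
    (order_lt_dim hp hsp hspN) hρ.2.1.1.aemeasurable hρ.1 hne).ne'
    (potentialPower_lt_top hp hsp hspN hρ).ne,
    (ENNReal.ofReal_toReal (potentialPower_lt_top hp hsp hspN hρ).ne).symm⟩

theorem exists_real_lintegral_rpow (hm : 1 < m) {ρ : RN N → ℝ} (hρ : ρ ∈ nonnegL1Lm N m) :
    ∃ A : ℝ, 0 ≤ A ∧ ∫⁻ x, ENNReal.ofReal (ρ x) ^ m = ENNReal.ofReal A :=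
  ⟨_, ENNReal.toReal_nonneg,
    (ENNReal.ofReal_toReal (lintegral_ofReal_rpow_lt_top (by linarith) hρ).ne).symm⟩

theorem hlsBestConst_pos (hp : 1 < p) (hsp : 0 < s * p) (hspN : s * p < N) :
    0 < hlsBestConst N s p (critExp N s p) := by
  obtain ⟨ρ, hρ⟩ := exists_forall_mem_massClass (N := N) one_pos
  exact hlsBestConst_pos_of_mem hp hsp hspN (hρ _).1
    (not_ae_eq_zero_of_mem_massClass one_pos (hρ (critExp N s p)))

theorem infEnergy_eq_bot_of_lt_critExp (hp : 1 < p) (hsp : 0 < s * p) (hspN : s * p < N)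
    (hχ : 0 < χ) (hM : 0 < M) (hm : 1 < m) (hmc : m < critExp N s p) :
    infEnergy N s p χ m M = ⊥ := by
  have hN : (0 : ℝ) < N := hsp.trans hspN
  have hq := one_lt_conjExp hp
  obtain ⟨ρ, hρ⟩ := exists_forall_mem_massClass (N := N) hM
  obtain ⟨A, hA0, hA⟩ := exists_real_lintegral_rpow hm (hρ m).1
  obtain ⟨B, hB0, hB⟩ := exists_real_potentialPower hp hsp hspN (hρ _).1
    (not_ae_eq_zero_of_mem_massClass hM (hρ m))
  refine eq_bot_of_forall_le_coe_of_tendsto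
    (fun t ht => infEnergy_le_dilate hp hN hχ hm (hρ m) hA0 hB0.le hA hB ht)
    (tendsto_rpow_mul_sub_rpow_mul_atBot ?_ ?_ (by positivity))
  · exact mul_lt_mul_of_pos_left (by linarith) hN
  · exact mul_pos hN (by linarith)

theorem infEnergy_neg_of_critExp_lt (hp : 1 < p) (hsp : 0 < s * p) (hspN : s * p < N)
    (hχ : 0 < χ) (hM : 0 < M) (hmc : critExp N s p < m) :
    infEnergy N s p χ m M < 0 := by
  have hN : (0 : ℝ) < N := hsp.trans hspN
  have hq := one_lt_conjExp hp
  have hm : 1 < m := (one_lt_critExp hp hsp hspN).trans hmc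
  have hm1 : 0 ≤ 1 / (m - 1) := one_div_nonneg.2 (by linarith)
  obtain ⟨ρ, hρ⟩ := exists_forall_mem_massClass (N := N) hM
  obtain ⟨A, hA0, hA⟩ := exists_real_lintegral_rpow hm (hρ m).1
  obtain ⟨B, hB0, hB⟩ := exists_real_potentialPower hp hsp hspN (hρ _).1
    (not_ae_eq_zero_of_mem_massClass hM (hρ m))
  obtain ⟨t, ht, hlt⟩ := exists_pos_rpow_mul_lt (a := N * (m - critExp N s p))
    (α := 1 / (m - 1) * A) (β := χ * (1 / conjExp p * B)) (mul_pos hN (by linarith))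
    (by positivity) (by positivity)
  refine (infEnergy_le_dilate hp hN hχ hm (hρ m) hA0 hB0.le hA hB ht).trans_lt ?_
  have he : t ^ (N * (m - 1)) =
      t ^ (N * (critExp N s p - 1)) * t ^ (N * (m - critExp N s p)) := by
    rw [← Real.rpow_add ht]
    congr 1
    ring
  rw [he, mul_assoc, ← mul_sub]
  exact_mod_cast mul_neg_of_pos_of_neg (Real.rpow_pos_of_pos ht _) (by linarith)

/-- The interpolation between `L^1` and `L^m`, pointwise and with a small constant in front of the
higher power. -/
theorem exists_rpow_le_mul_rpow_add_mul {l : ℝ} (hl : 1 ≤ l) (hlm : l < m) {ε : ℝ} (hε : 0 < ε) :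
    ∃ C : ℝ, 0 ≤ C ∧ ∀ x : ℝ≥0∞,
      x ^ l ≤ ENNReal.ofReal ε * x ^ m + ENNReal.ofReal C * x := by
  have hml : 0 < m - l := by linarith
  set R := (1 / ε) ^ (1 / (m - l)) with hR
  have hR0 : 0 < R := Real.rpow_pos_of_pos (by positivity) _
  have hRe : ε * R ^ (m - l) = 1 := by
    rw [hR, ← Real.rpow_mul (by positivity), one_div_mul_cancel hml.ne', Real.rpow_one]
    field_simp
  refine ⟨R ^ (l - 1), by positivity, fun x => ?_⟩
  rcases le_total (ENNReal.ofReal R) x with h | h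
  · refine le_add_right ?_
    calc x ^ l = ENNReal.ofReal ε * ENNReal.ofReal R ^ (m - l) * x ^ l := by
          rw [ENNReal.ofReal_rpow_of_pos hR0, ← ENNReal.ofReal_mul hε.le, hRe, ENNReal.ofReal_one,
            one_mul]
      _ ≤ ENNReal.ofReal ε * x ^ (m - l) * x ^ l := by gcongr
      _ = ENNReal.ofReal ε * x ^ m := by
          rw [mul_assoc, ← ENNReal.rpow_add_of_nonneg _ _ hml.le (by linarith), sub_add_cancel]
  · refine le_add_left ?_
    calc x ^ l = x ^ (l - 1) * x := by
          conv_rhs => rw [← ENNReal.rpow_one x, ← ENNReal.rpow_mul, one_mul,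
            ← ENNReal.rpow_add_of_nonneg _ _ (by linarith) zero_le_one, sub_add_cancel]
      _ ≤ ENNReal.ofReal R ^ (l - 1) * x := by gcongr
      _ = _ := by rw [ENNReal.ofReal_rpow_of_pos hR0]

theorem mem_nonnegL1Lm_of_lintegral_lt_top {l : ℝ} (hl : 0 < l) {ρ : RN N → ℝ}
    (hρ : ρ ∈ nonnegL1Lm N m) (h : ∫⁻ x, ENNReal.ofReal (ρ x) ^ l < ⊤) :
    ρ ∈ nonnegL1Lm N l := by
  refine ⟨hρ.1, hρ.2.1, hρ.2.1.1, ?_⟩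
  rw [lintegral_ofReal_rpow_eq_eLpNorm_rpow hl hρ.1] at h
  exact (ENNReal.rpow_lt_top_iff_of_pos hl).1 h

/-- The best constant inequality for densities of mass `M`, in real numbers. -/
theorem le_of_potentialPower_eq (hp : 1 < p) (hsp : 0 < s * p) (hspN : s * p < N)
    (hM : 0 < M) {ρ : RN N → ℝ} (hρ : ρ ∈ nonnegL1Lm N (critExp N s p))
    (hρM : ∫⁻ x, ENNReal.ofReal (ρ x) = ENNReal.ofReal M) {A B : ℝ} (hA0 : 0 ≤ A)
    (hA : ∫⁻ x, ENNReal.ofReal (ρ x) ^ critExp N s p = ENNReal.ofReal A)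
    (hB : potentialPower N s p ρ = ENNReal.ofReal B) :
    B ≤ (hlsBestConst N s p (critExp N s p)).toReal *
      (M ^ (conjExp p - critExp N s p) * A) := by
  have h := potentialPower_le_hlsBestConst hp hsp hspN hρ
  rw [hA, hB, hρM, ← ENNReal.ofReal_toReal (hlsBestConst_lt_top hp hsp hspN).ne,
    ENNReal.ofReal_rpow_of_pos hM, ← ENNReal.ofReal_mul (by positivity),
    ← ENNReal.ofReal_mul ENNReal.toReal_nonneg, ENNReal.ofReal_le_ofReal_iff (by positivity)] at h
  exact h

theorem exists_le_infEnergy_of_critExp_lt (hp : 1 < p) (hsp : 0 < s * p) (hspN : s * p < N)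
    (hχ : 0 < χ) (hM : 0 < M) (hmc : critExp N s p < m) :
    ∃ L : ℝ, (L : EReal) ≤ infEnergy N s p χ m M := by
  have hq := one_lt_conjExp hp
  have hc1 := one_lt_critExp hp hsp hspN
  have hm : 1 < m := hc1.trans hmc
  have hm1 : 0 < 1 / (m - 1) := one_div_pos.2 (by linarith)
  have hH : 0 < (hlsBestConst N s p (critExp N s p)).toReal :=
    ENNReal.toReal_pos (hlsBestConst_pos hp hsp hspN).ne' (hlsBestConst_lt_top hp hsp hspN).ne
  set H := (hlsBestConst N s p (critExp N s p)).toReal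
  -- the constant in front of the critical power in the bound of the interaction energy
  set κ := χ * (1 / conjExp p * (H * M ^ (conjExp p - critExp N s p))) with hκ
  have hκ0 : 0 < κ := by positivity
  obtain ⟨C, hC0, hC⟩ := exists_rpow_le_mul_rpow_add_mul hc1.le hmc
    (ε := 1 / (m - 1) / κ) (by positivity)
  refine ⟨-(κ * (C * M)), le_iInf₂ fun ρ hρ => ?_⟩
  obtain ⟨A, hA0, hA⟩ := exists_real_lintegral_rpow hm hρ.1
  have hρM := lintegral_ofReal_of_mem_massClass hρ
  have hmeas : AEMeasurable fun x => ENNReal.ofReal (ρ x) :=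
    hρ.1.2.1.1.aemeasurable.ennreal_ofReal
  have hint : ∫⁻ x, ENNReal.ofReal (ρ x) ^ critExp N s p ≤
      ENNReal.ofReal (1 / (m - 1) / κ * A + C * M) := by
    refine (lintegral_mono fun x => hC (ENNReal.ofReal (ρ x))).trans_eq ?_
    rw [lintegral_add_left' ((hmeas.pow_const m).const_mul _),
      lintegral_const_mul' _ _ ENNReal.ofReal_ne_top, lintegral_const_mul' _ _ ENNReal.ofReal_ne_top,
      hA, hρM, ← ENNReal.ofReal_mul (by positivity), ← ENNReal.ofReal_mul hC0,
      ← ENNReal.ofReal_add (by positivity) (by positivity)]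
  have hρc : ρ ∈ nonnegL1Lm N (critExp N s p) :=
    mem_nonnegL1Lm_of_lintegral_lt_top (by linarith) hρ.1 (hint.trans_lt ENNReal.ofReal_lt_top)
  obtain ⟨A', hA0', hA'⟩ := exists_real_lintegral_rpow hc1 hρc
  obtain ⟨B, hB0, hB⟩ := exists_real_potentialPower hp hsp hspN hρc
    (not_ae_eq_zero_of_mem_massClass hM hρ)
  have hAA : A' ≤ 1 / (m - 1) / κ * A + C * M := by
    rwa [hA', ENNReal.ofReal_le_ofReal_iff (by positivity)] at hint
  have hBle := le_of_potentialPower_eq hp hsp hspN hM hρc hρM hA0' hA' hB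
  rw [freeEnergy_eq_coe hp hχ hm hA0 hB0.le hA hB]
  have h1 : χ * (1 / conjExp p * B) ≤ κ * A' := by
    calc χ * (1 / conjExp p * B)
        ≤ χ * (1 / conjExp p * (H * (M ^ (conjExp p - critExp N s p) * A'))) := by gcongr
      _ = κ * A' := by rw [hκ]; ring
  have h2 : κ * A' ≤ 1 / (m - 1) * A + κ * (C * M) := by
    calc κ * A' ≤ κ * (1 / (m - 1) / κ * A + C * M) := by gcongr
      _ = _ := by rw [mul_add]; congr 1; field_simp
  exact_mod_cast (by linarith : -(κ * (C * M)) ≤ 1 / (m - 1) * A - χ * (1 / conjExp p * B))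

/-- The condition `M ≤ M_c` in the form in which it makes the bound of the interaction energy by the
best constant at most the internal energy. -/
theorem le_critMass_iff (hp : 1 < p) (hsp : 0 < s * p) (hspN : s * p < N) (hχ : 0 < χ)
    (hM : 0 < M) :
    M ≤ critMass N s p χ ↔ (hlsBestConst N s p (critExp N s p)).toReal *
      M ^ (conjExp p - critExp N s p) ≤ sobolevExp N s p / χ := by
  have hN : (0 : ℝ) < N := hsp.trans hspN
  have hs := pos_of_mul_pos_of_one_lt hp hsp
  have hq := one_lt_conjExp hp
  have hS := sobolevExp_pos hp hsp hspN
  have hH : 0 < (hlsBestConst N s p (critExp N s p)).toReal :=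
    ENNReal.toReal_pos (hlsBestConst_pos hp hsp hspN).ne' (hlsBestConst_lt_top hp hsp hspN).ne
  have he : (N : ℝ) / (s * conjExp p) = (s * conjExp p / N)⁻¹ := (inv_div _ _).symm
  rw [critMass, conjExp_sub_critExp, he,
    Real.le_rpow_inv_iff_of_pos hM.le (by positivity) (by positivity), le_div_iff₀ (by positivity),
    le_div_iff₀ hχ]
  constructor <;> intro h <;> linarith

theorem sobolevExp_eq_conjExp_mul (hp : 1 < p) (hsp : 0 < s * p) (hspN : s * p < N) :
    sobolevExp N s p = conjExp p * (1 / (critExp N s p - 1)) := by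
  have hm := one_lt_critExp hp hsp hspN
  have : critExp N s p - 1 ≠ 0 := by linarith
  rw [← critExp_sub_one_mul_sobolevExp hp hsp hspN]
  field_simp

theorem infEnergy_critExp_eq_zero (hp : 1 < p) (hsp : 0 < s * p) (hspN : s * p < N)
    (hχ : 0 < χ) (hM : 0 < M) (hMc : M ≤ critMass N s p χ) :
    infEnergy N s p χ (critExp N s p) M = 0 := by
  have hN : (0 : ℝ) < N := hsp.trans hspN
  have hq := one_lt_conjExp hp
  have hm := one_lt_critExp hp hsp hspN
  have hm1 : 0 < 1 / (critExp N s p - 1) := one_div_pos.2 (by linarith)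
  refine le_antisymm ?_ (le_iInf₂ fun ρ hρ => ?_)
  · -- spreading the mass sends both parts of the energy to zero
    by_contra! hpos
    obtain ⟨r, hr0, hr⟩ := EReal.lt_iff_exists_real_btwn.1 hpos
    have hr0' : 0 < r := by exact_mod_cast hr0
    obtain ⟨ρ, hρ⟩ := exists_forall_mem_massClass (N := N) hM
    obtain ⟨A, hA0, hA⟩ := exists_real_lintegral_rpow hm (hρ _).1
    obtain ⟨B, hB0, hB⟩ := exists_real_potentialPower hp hsp hspN (hρ _).1
      (not_ae_eq_zero_of_mem_massClass hM (hρ (critExp N s p)))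
    obtain ⟨t, ht, hlt⟩ := exists_pos_rpow_mul_lt (a := N * (critExp N s p - 1))
      (α := 1 / (critExp N s p - 1) * A) (mul_pos hN (by linarith)) (by positivity) hr0'
    have h1 := hr.trans_le (infEnergy_le_dilate hp hN hχ hm (hρ _) hA0 hB0.le hA hB ht)
    have h2 := EReal.coe_lt_coe_iff.1 h1
    have h3 : 0 ≤ t ^ (N * (critExp N s p - 1)) * (χ * (1 / conjExp p * B)) := by positivity
    linarith
  · obtain ⟨A, hA0, hA⟩ := exists_real_lintegral_rpow hm hρ.1
    obtain ⟨B, hB0, hB⟩ := exists_real_potentialPower hp hsp hspN hρ.1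
      (not_ae_eq_zero_of_mem_massClass hM hρ)
    have hBle := le_of_potentialPower_eq hp hsp hspN hM hρ.1
      (lintegral_ofReal_of_mem_massClass hρ) hA0 hA hB
    have hle := (le_critMass_iff hp hsp hspN hχ hM).1 hMc
    rw [freeEnergy_eq_coe hp hχ hm hA0 hB0.le hA hB]
    set H := (hlsBestConst N s p (critExp N s p)).toReal
    have h1 : χ * (1 / conjExp p * B) ≤ 1 / (critExp N s p - 1) * A := by
      calc χ * (1 / conjExp p * B)
          ≤ χ * (1 / conjExp p * (H * (M ^ (conjExp p - critExp N s p) * A))) := by gcongr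
        _ = χ * (1 / conjExp p * ((H * M ^ (conjExp p - critExp N s p)) * A)) := by ring
        _ ≤ χ * (1 / conjExp p * (sobolevExp N s p / χ * A)) := by gcongr
        _ = _ := by rw [sobolevExp_eq_conjExp_mul hp hsp hspN]; field_simp
    exact_mod_cast sub_nonneg.2 h1

theorem infEnergy_critExp_eq_bot (hp : 1 < p) (hsp : 0 < s * p) (hspN : s * p < N)
    (hχ : 0 < χ) (hM : 0 < M) (hMc : critMass N s p χ < M) :
    infEnergy N s p χ (critExp N s p) M = ⊥ := by
  have hN : (0 : ℝ) < N := hsp.trans hspN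
  have hq := one_lt_conjExp hp
  have hm := one_lt_critExp hp hsp hspN
  have hS := sobolevExp_pos hp hsp hspN
  have hHlt := not_le.1 (mt (le_critMass_iff hp hsp hspN hχ hM).2 (not_le.2 hMc))
  have hMpos : 0 < M ^ (conjExp p - critExp N s p) := Real.rpow_pos_of_pos hM _
  -- the constant for which the two parts of the energy balance at mass `M`
  set c := sobolevExp N s p / χ / M ^ (conjExp p - critExp N s p) with hc
  have hc0 : 0 < c := by positivity
  have hcH : ENNReal.ofReal c < hlsBestConst N s p (critExp N s p) := by
    rw [ENNReal.ofReal_lt_iff_lt_toReal hc0.le (hlsBestConst_lt_top hp hsp hspN).ne, hc,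
      div_lt_iff₀ hMpos]
    exact hHlt
  obtain ⟨ρ, hρ, hlt⟩ := exists_mem_massClass_lt_potentialPower hp hsp hspN hM hcH
  obtain ⟨A, hA0, hA⟩ := exists_real_lintegral_rpow hm hρ.1
  obtain ⟨B, hB0, hB⟩ := exists_real_potentialPower hp hsp hspN hρ.1
    (not_ae_eq_zero_of_mem_massClass hM hρ)
  rw [hA, hB, ENNReal.ofReal_rpow_of_pos hM, ← ENNReal.ofReal_mul hMpos.le,
    ← ENNReal.ofReal_mul hc0.le, ENNReal.ofReal_lt_ofReal_iff hB0] at hlt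
  have hneg : 1 / (critExp N s p - 1) * A - χ * (1 / conjExp p * B) < 0 := by
    rw [sub_neg]
    calc 1 / (critExp N s p - 1) * A
        = χ * (1 / conjExp p * (c * (M ^ (conjExp p - critExp N s p) * A))) := by
          rw [hc, sobolevExp_eq_conjExp_mul hp hsp hspN]; field_simp
      _ < χ * (1 / conjExp p * B) := by gcongr
  refine eq_bot_of_forall_le_coe_of_tendsto
    (fun t ht => infEnergy_le_dilate hp hN hχ hm hρ hA0 hB0.le hA hB ht) ?_
  simp_rw [← mul_sub]
  exact (tendsto_rpow_atTop (mul_pos hN (by linarith))).atTop_mul_const_of_neg hneg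

end Regimes

theorem mainTheorem4 (N : ℕ) (s p χ M : ℝ) (hp : 1 < p) (hsp : 0 < s * p)
    (hspN : s * p < (N : ℝ)) (hχ : 0 < χ) (hM : 0 < M) :
    -- aggregation dominated regime
    (∀ m : ℝ, 1 < m → m < critExp N s p → infEnergy N s p χ m M = ⊥) ∧
    -- diffusion dominated regime
    (∀ m : ℝ, critExp N s p < m →
      ∃ μ : ℝ, μ < 0 ∧ infEnergy N s p χ m M = (μ : EReal)) ∧
    -- fair competition regime; the best constant that defines the critical mass is in `(0, ∞)`
    (0 < hlsBestConst N s p (critExp N s p) ∧ hlsBestConst N s p (critExp N s p) < ⊤) ∧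
    (M ≤ critMass N s p χ → infEnergy N s p χ (critExp N s p) M = 0) ∧
    (critMass N s p χ < M → infEnergy N s p χ (critExp N s p) M = ⊥) := by
  refine ⟨fun m hm hmc => infEnergy_eq_bot_of_lt_critExp hp hsp hspN hχ hM hm hmc,
    fun m hmc => ?_, ⟨hlsBestConst_pos hp hsp hspN, hlsBestConst_lt_top hp hsp hspN⟩,
    infEnergy_critExp_eq_zero hp hsp hspN hχ hM, infEnergy_critExp_eq_bot hp hsp hspN hχ hM⟩
  have hneg := infEnergy_neg_of_critExp_lt hp hsp hspN hχ hM hmc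
  obtain ⟨L, hL⟩ := exists_le_infEnergy_of_critExp_lt hp hsp hspN hχ hM hmc
  have hcoe := EReal.coe_toReal (hneg.trans EReal.zero_lt_top).ne
    ((EReal.bot_lt_coe L).trans_le hL).ne'
  refine ⟨(infEnergy N s p χ m M).toReal, ?_, hcoe.symm⟩
  rw [← hcoe] at hneg
  exact_mod_cast hneg
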